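/- For a finite simple graph $G$ on $n$ vertices let $\mathcal{E}(G)=\sum_{r=1}^{n}|\lambda_r|$ be its energy, where $\lambda_1,\dots,\lambda_n$ are the eigenvalues, counted with multiplicity, of the adjacency matrix of $G$. Let $k\ge 2$, let $t_1,\dots,t_k\ge 1$ be integers, and let $K_{t_1,\dots,t_k}$ be the complete multipartite graph with $k$ parts of sizes $t_1,\dots,t_k$ (two vertices are adjacent if and only if they lie in different parts). Let $i\ne j$, let $e$ be an edge joining a vertex of the $i$-th part to a vertex of the $j$-th part, and let $K_{t_1,\dots,t_k}-e$ be the graph on the same vertices obtained by deleting $e$. Then: 1. For $k\ge 4$: if $t_i=t_j=1$, then $\mathcal{E}(K_{t_1,\dots,t_k}-e)<\mathcal{E}(K_{t_1,\dots,t_k})$; otherwise $\mathcal{E}(K_{t_1,\dots,t_k}-e)>\mathcal{E}(K_{t_1,\dots,t_k})$. 2. For $k=3$: if $t_i+t_j\le 3$, then $\mathcal{E}(K_{t_1,\dots,t_k}-e)<\mathcal{E}(K_{t_1,\dots,t_k})$; otherwise $\mathcal{E}(K_{t_1,\dots,t_k}-e)>\mathcal{E}(K_{t_1,\dots,t_k})$.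 3. For $k=2$: if $\min\{t_i,t_j\}=1$, then $\mathcal{E}(K_{t_1,\dots,t_k}-e)<\mathcal{E}(K_{t_1,\dots,t_k})$; otherwise $\mathcal{E}(K_{t_1,\dots,t_k}-e)>\mathcal{E}(K_{t_1,\dots,t_k})$. -/

import Mathlib

open Classical in
/-- The energy of a finite simple graph: the sum of the absolute values of the eigenvalues,
counted with multiplicity, of its real adjacency matrix. -/
noncomputable def SimpleGraph.energy {V : Type*} [Fintype V] (G : SimpleGraph V) : ℝ :=
  ∑ v, |(G.isHermitian_adjMatrix ℝ).eigenvalues v|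

/-- The complete multipartite graph whose parts are indexed by `Fin k`, the `i`-th part having
`t i` vertices: two vertices are adjacent iff they lie in different parts. -/
abbrev multipartite {k : ℕ} (t : Fin k → ℕ) : SimpleGraph (Σ i, Fin (t i)) :=
  SimpleGraph.completeMultipartiteGraph fun i => Fin (t i)

open Matrix Finset

/-! ### Spectral inequalities for real symmetric matrices. -/

namespace Matrix.IsHermitian

/-! An adjacency matrix has trace zero, so the energy is twice the sum of the positive eigenvalues.
The quadratic form of a complete multipartite graph is `(∑ x)² - ∑ (class sums)²`, which is
nonpositive where `∑ x = 0`. There is thus one positive eigenvalue `ρ`, the root of `∑ n_l / (ρ +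
n_l) = 1`, and the energy is `2ρ`. Everything reduces to comparing the positive eigenvalue sum of `G
- e` with `ρ`.

Increase, both parts of size at least 2 (`energy_lt_deleteEdge_of_two_le`): by Ky Fan, two
orthogonal test vectors suffice. The Perron vector of `G` loses less than 1/2, and a vector with
zero class sums gains at least 1/2. The 4-cycle is the equality case and gets its own vectors.

Increase, one part of size 1 (`energy_lt_deleteEdge_of_one`): this margin is unavailable, so two
positive eigenvalues of `G - e` are located as roots of a secular equation. Concavity replaces the
remaining parts by one part of real size `τ` (or by parts of sizes 1 and `τ`) with the same `ρ`.
What remains is a quartic, written as a factor symmetric under `x ↦ ρ - x` times an increasing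
factor, plus a positive constant. Its small root `μ` is then reflected to a point `ρ - μ` below the
large root, so the two roots sum to more than `ρ`.

Decrease: for two singleton parts, deletion merges them, and for a star it detaches a leaf; both
results still have at most one positive eigenvalue. For sizes 1, 2, `t`
(`deleteEdge_energy_lt_of_one_two`) a positive semidefinite dual certificate of trace below `ρ`
bounds the positive eigenvalue sum. -/

theorem sq_dotProduct_add_sq_dotProduct_le_one {n : Type*} [Fintype n]
    (v x y : n → ℝ) (hv : v ⬝ᵥ v = 1)
    (hxy : x ⬝ᵥ y = 0) (hx : 0 < x ⬝ᵥ x) (hy : 0 < y ⬝ᵥ y) :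
    (v ⬝ᵥ x) ^ 2 / (x ⬝ᵥ x) + (v ⬝ᵥ y) ^ 2 / (y ⬝ᵥ y) ≤ 1 := by
  set r := v - ((v ⬝ᵥ x) / (x ⬝ᵥ x)) • x - ((v ⬝ᵥ y) / (y ⬝ᵥ y)) • y with hr
  have h0 : 0 ≤ r ⬝ᵥ r := by
    simp only [dotProduct]
    exact Finset.sum_nonneg fun i _ => mul_self_nonneg _
  have h1 : r ⬝ᵥ r = 1 - (v ⬝ᵥ x) ^ 2 / (x ⬝ᵥ x) - (v ⬝ᵥ y) ^ 2 / (y ⬝ᵥ y) := by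
    simp only [hr, sub_dotProduct, dotProduct_sub, smul_dotProduct, dotProduct_smul, smul_eq_mul,
      hv, hxy, dotProduct_comm y x, dotProduct_comm x v, dotProduct_comm y v]
    field_simp
    ring
  linarith

theorem dotProduct_mulVec_comm {n : Type*} [Fintype n] {A : Matrix n n ℝ}
    (hA : A.IsHermitian) (x y : n → ℝ) :
    x ⬝ᵥ A *ᵥ y = A *ᵥ x ⬝ᵥ y := by
  rw [dotProduct_mulVec, ← mulVec_transpose]
  congr 2

theorem dotProduct_eq_zero_of_mulVec {n : Type*} [Fintype n] {A : Matrix n n ℝ}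
    (hA : A.IsHermitian) {x y : n → ℝ} {α β : ℝ} (hαβ : α ≠ β)
    (hx : A *ᵥ x = α • x) (hy : A *ᵥ y = β • y) : x ⬝ᵥ y = 0 := by
  have h := hA.dotProduct_mulVec_comm x y
  rw [hx, hy, dotProduct_smul, smul_dotProduct, smul_eq_mul, smul_eq_mul] at h
  have h' : (β - α) * (x ⬝ᵥ y) = 0 := by linarith
  exact (mul_eq_zero.mp h').resolve_left (sub_ne_zero.mpr hαβ.symm)

variable {n : Type*} [Fintype n] [DecidableEq n] {A : Matrix n n ℝ}

/-- The `i`-th member of an orthonormal eigenbasis, as a plain vector. -/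
noncomputable def eigvec (hA : A.IsHermitian) (i : n) : n → ℝ := ⇑(hA.eigenvectorBasis i)

theorem dotProduct_eq_sum_eigvec (hA : A.IsHermitian) (x y : n → ℝ) :
    x ⬝ᵥ y = ∑ i, (hA.eigvec i ⬝ᵥ x) * (hA.eigvec i ⬝ᵥ y) := by
  have h := hA.eigenvectorBasis.sum_inner_mul_inner (WithLp.toLp 2 x) (WithLp.toLp 2 y)
  simp only [EuclideanSpace.inner_eq_star_dotProduct, star_trivial] at h
  rw [dotProduct_comm, ← h]
  refine Finset.sum_congr rfl fun i _ => ?_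
  simp only [eigvec]
  rw [dotProduct_comm y]

theorem mulVec_eigvec (hA : A.IsHermitian) (i : n) :
    A *ᵥ hA.eigvec i = hA.eigenvalues i • hA.eigvec i := by
  simpa [eigvec] using hA.mulVec_eigenvectorBasis i

theorem eigvec_dotProduct_eigvec (hA : A.IsHermitian) (i j : n) :
    hA.eigvec i ⬝ᵥ hA.eigvec j = if i = j then 1 else 0 := by
  have h := orthonormal_iff_ite.mp hA.eigenvectorBasis.orthonormal j i
  simp only [EuclideanSpace.inner_eq_star_dotProduct, star_trivial] at h
  simp only [eigvec, h, eq_comm]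

theorem dotProduct_mulVec_eq_sum (hA : A.IsHermitian) (x : n → ℝ) :
    x ⬝ᵥ A *ᵥ x = ∑ i, hA.eigenvalues i * (hA.eigvec i ⬝ᵥ x) ^ 2 := by
  rw [hA.dotProduct_eq_sum_eigvec]
  refine Finset.sum_congr rfl fun i _ => ?_
  rw [hA.dotProduct_mulVec_comm, hA.mulVec_eigvec, smul_dotProduct, smul_eq_mul]
  ring

theorem eigvec_dotProduct_mulVec (hA : A.IsHermitian) (i : n) :
    hA.eigvec i ⬝ᵥ A *ᵥ hA.eigvec i = hA.eigenvalues i := by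
  rw [hA.mulVec_eigvec, dotProduct_smul, hA.eigvec_dotProduct_eigvec]
  simp

theorem sum_abs_eigenvalues (hA : A.IsHermitian) (htr : A.trace = 0) :
    ∑ i, |hA.eigenvalues i| = 2 * ∑ i, max (hA.eigenvalues i) 0 := by
  have h : ∑ i, hA.eigenvalues i = 0 := by
    have := hA.trace_eq_sum_eigenvalues
    rw [htr] at this
    simpa using this.symm
  have h2 : ∀ i, |hA.eigenvalues i| = 2 * max (hA.eigenvalues i) 0 - hA.eigenvalues i := by
    intro i
    rcases le_total 0 (hA.eigenvalues i) with h | h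
    · rw [abs_of_nonneg h, max_eq_left h]; ring
    · rw [abs_of_nonpos h, max_eq_right h]; ring
  rw [Finset.sum_congr rfl fun i _ => h2 i, Finset.sum_sub_distrib, h, Finset.mul_sum]
  simp

/-- A two-dimensional case of Ky Fan's principle. -/
theorem rayleigh_add_rayleigh_le (hA : A.IsHermitian) (x y : n → ℝ)
    (hxy : x ⬝ᵥ y = 0) (hx : 0 < x ⬝ᵥ x) (hy : 0 < y ⬝ᵥ y) :
    (x ⬝ᵥ A *ᵥ x) / (x ⬝ᵥ x) + (y ⬝ᵥ A *ᵥ y) / (y ⬝ᵥ y) ≤ ∑ i, max (hA.eigenvalues i) 0 := by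
  rw [hA.dotProduct_mulVec_eq_sum x, hA.dotProduct_mulVec_eq_sum y, Finset.sum_div,
    Finset.sum_div, ← Finset.sum_add_distrib]
  refine Finset.sum_le_sum fun i _ => ?_
  have h := sq_dotProduct_add_sq_dotProduct_le_one (hA.eigvec i) x y
    (by simp [hA.eigvec_dotProduct_eigvec]) hxy hx hy
  set w := (hA.eigvec i ⬝ᵥ x) ^ 2 / (x ⬝ᵥ x) + (hA.eigvec i ⬝ᵥ y) ^ 2 / (y ⬝ᵥ y) with hw
  have h0 : 0 ≤ w := by positivity
  calc _ = hA.eigenvalues i * w := by rw [hw]; ring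
    _ ≤ max (hA.eigenvalues i) 0 * w := by gcongr; exact le_max_left _ _
    _ ≤ max (hA.eigenvalues i) 0 * 1 := by gcongr
    _ = _ := mul_one _

theorem rayleigh_le (hA : A.IsHermitian) (x : n → ℝ) (hx : 0 < x ⬝ᵥ x) :
    (x ⬝ᵥ A *ᵥ x) / (x ⬝ᵥ x) ≤ ∑ i, max (hA.eigenvalues i) 0 := by
  rw [hA.dotProduct_mulVec_eq_sum x, Finset.sum_div]
  refine Finset.sum_le_sum fun i _ => ?_
  have h : (hA.eigvec i ⬝ᵥ x) ^ 2 / (x ⬝ᵥ x) ≤ 1 := by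
    rw [div_le_one hx, hA.dotProduct_eq_sum_eigvec x x, sq]
    exact Finset.single_le_sum
      (f := fun i => (hA.eigvec i ⬝ᵥ x) * (hA.eigvec i ⬝ᵥ x))
      (fun j _ => mul_self_nonneg _) (Finset.mem_univ i)
  rw [mul_div_assoc]
  calc _ ≤ max (hA.eigenvalues i) 0 * ((hA.eigvec i ⬝ᵥ x) ^ 2 / (x ⬝ᵥ x)) := by
        gcongr; exact le_max_left _ _
    _ ≤ max (hA.eigenvalues i) 0 * 1 := by gcongr
    _ = _ := mul_one _

theorem add_le_of_mulVec (hA : A.IsHermitian) {x y : n → ℝ} {α β : ℝ} (hαβ : α ≠ β)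
    (hx : A *ᵥ x = α • x) (hy : A *ᵥ y = β • y) (hx0 : 0 < x ⬝ᵥ x) (hy0 : 0 < y ⬝ᵥ y) :
    α + β ≤ ∑ i, max (hA.eigenvalues i) 0 := by
  have h := hA.rayleigh_add_rayleigh_le x y (hA.dotProduct_eq_zero_of_mulVec hαβ hx hy) hx0 hy0
  rw [hx, hy, dotProduct_smul, dotProduct_smul, smul_eq_mul, smul_eq_mul,
    mul_div_cancel_right₀ _ hx0.ne', mul_div_cancel_right₀ _ hy0.ne'] at h
  exact h

/-- If the quadratic form is nonpositive on a hyperplane and bounded by `ρ`, then the positive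
eigenvalues sum to at most `ρ`. -/
theorem sum_pos_eigenvalues_le (hA : A.IsHermitian) (z : n → ℝ) (ρ : ℝ) (hρ0 : 0 ≤ ρ)
    (hz : ∀ x : n → ℝ, z ⬝ᵥ x = 0 → x ⬝ᵥ A *ᵥ x ≤ 0)
    (hρ : ∀ x : n → ℝ, x ⬝ᵥ A *ᵥ x ≤ ρ * (x ⬝ᵥ x)) :
    ∑ i, max (hA.eigenvalues i) 0 ≤ ρ := by
  have hle : ∀ i, hA.eigenvalues i ≤ ρ := by
    intro i
    have := hρ (hA.eigvec i)
    rwa [hA.eigvec_dotProduct_mulVec, hA.eigvec_dotProduct_eigvec, if_pos rfl, mul_one] at this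
  by_cases hex : ∃ i, 0 < hA.eigenvalues i
  · obtain ⟨i, hi⟩ := hex
    have hother : ∀ j, j ≠ i → hA.eigenvalues j ≤ 0 := by
      intro j hj
      by_contra! hjp
      set p := z ⬝ᵥ hA.eigvec i
      set q := z ⬝ᵥ hA.eigvec j
      -- The form is positive definite on the span of two eigenvectors with positive eigenvalues, so
      -- this plane could meet the hyperplane only in 0; but `(q, -p)` always lies in the
      -- hyperplane.
      have key : ∀ a b : ℝ, a * p + b * q = 0 → a = 0 ∧ b = 0 := by
        intro a b hab
        have h1 := hz (a • hA.eigvec i + b • hA.eigvec j) (by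
          simpa [dotProduct_add, dotProduct_smul] using hab)
        have h2 : (a • hA.eigvec i + b • hA.eigvec j) ⬝ᵥ
            A *ᵥ (a • hA.eigvec i + b • hA.eigvec j) =
            a ^ 2 * hA.eigenvalues i + b ^ 2 * hA.eigenvalues j := by
          simp only [mulVec_add, mulVec_smul, hA.mulVec_eigvec, add_dotProduct, dotProduct_add,
            smul_dotProduct, dotProduct_smul, hA.eigvec_dotProduct_eigvec, if_neg hj,
            if_neg hj.symm, if_pos, smul_eq_mul]
          ring
        rw [h2] at h1
        have ha : 0 ≤ a ^ 2 * hA.eigenvalues i := by positivity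
        have hb : 0 ≤ b ^ 2 * hA.eigenvalues j := by positivity
        constructor
        · have : a ^ 2 * hA.eigenvalues i = 0 := by linarith
          simpa [hi.ne'] using this
        · have : b ^ 2 * hA.eigenvalues j = 0 := by linarith
          simpa [hjp.ne'] using this
      have h1 := key q (-p) (by ring)
      have h2 := key 1 0 (by rw [neg_eq_zero.mp h1.2]; ring)
      exact one_ne_zero h2.1
    rw [Finset.sum_eq_single i (fun j _ hj => max_eq_right (hother j hj))
      (fun h => absurd (Finset.mem_univ i) h)]
    exact max_le (hle i) hρ0
  · push Not at hex
    rw [Finset.sum_eq_zero fun i _ => max_eq_right (hex i)]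
    exact hρ0

/-- Dual bound: if `N` and `A + N` are positive semidefinite, then the positive
eigenvalues of the traceless matrix `A` sum to at most `tr N`. -/
theorem sum_pos_eigenvalues_le_trace (hA : A.IsHermitian) (htr : A.trace = 0) (N : Matrix n n ℝ)
    (hN : ∀ x : n → ℝ, 0 ≤ x ⬝ᵥ N *ᵥ x) (hAN : ∀ x : n → ℝ, 0 ≤ x ⬝ᵥ A *ᵥ x + x ⬝ᵥ N *ᵥ x) :
    ∑ i, max (hA.eigenvalues i) 0 ≤ N.trace := by
  have h : ∑ i, hA.eigenvalues i = 0 := by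
    have := hA.trace_eq_sum_eigenvalues
    rw [htr] at this
    simpa using this.symm
  have htrN : N.trace = ∑ i, hA.eigvec i ⬝ᵥ N *ᵥ hA.eigvec i := by
    have e : ∀ p, N p p = ∑ i, hA.eigvec i p * (N *ᵥ hA.eigvec i) p := by
      intro p
      have h1 := hA.dotProduct_eq_sum_eigvec (Pi.single p 1) (N.row p)
      simp only [single_dotProduct, dotProduct_single, mul_one, one_mul] at h1
      rw [Matrix.row] at h1
      rw [h1]
      refine Finset.sum_congr rfl fun i _ => ?_
      rw [mulVec, dotProduct_comm (N p)]
    simp only [trace, diag, dotProduct]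
    rw [Finset.sum_congr rfl fun p _ => e p, Finset.sum_comm]
  -- Trace zero turns the positive parts into negative parts, and `max λ 0 - λ` is exactly what `N`
  -- and `A + N` being nonnegative on the eigenvector bounds.
  have h2 : ∑ i, max (hA.eigenvalues i) 0 = ∑ i, (max (hA.eigenvalues i) 0 - hA.eigenvalues i) := by
    rw [Finset.sum_sub_distrib, h, sub_zero]
  rw [h2, htrN]
  refine Finset.sum_le_sum fun i _ => ?_
  have a1 := hN (hA.eigvec i)
  have a2 := hAN (hA.eigvec i)
  rw [hA.eigvec_dotProduct_mulVec] at a2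
  rcases le_total 0 (hA.eigenvalues i) with h | h
  · rw [max_eq_left h]; linarith
  · rw [max_eq_right h]; linarith

end Matrix.IsHermitian

namespace SimpleGraph

/-! ### Energy bounds for graphs and the effect of deleting an edge on the form. -/

section Energy

variable {V : Type*} [Fintype V] [DecidableEq V] (G : SimpleGraph V) [DecidableRel G.Adj]

theorem energy_eq_two_mul_sum_pos :
    G.energy = 2 * ∑ v, max ((G.isHermitian_adjMatrix ℝ).eigenvalues v) 0 := by
  rw [← (G.isHermitian_adjMatrix ℝ).sum_abs_eigenvalues (G.trace_adjMatrix ℝ)]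
  unfold energy
  congr!

variable {G}

theorem two_mul_rayleigh_le_energy (x : V → ℝ) (hx : 0 < x ⬝ᵥ x) :
    2 * ((x ⬝ᵥ G.adjMatrix ℝ *ᵥ x) / (x ⬝ᵥ x)) ≤ G.energy := by
  have := (G.isHermitian_adjMatrix ℝ).rayleigh_le x hx
  rw [G.energy_eq_two_mul_sum_pos]
  linarith

theorem two_mul_rayleigh_add_rayleigh_le_energy (x y : V → ℝ) (hxy : x ⬝ᵥ y = 0)
    (hx : 0 < x ⬝ᵥ x) (hy : 0 < y ⬝ᵥ y) :
    2 * ((x ⬝ᵥ G.adjMatrix ℝ *ᵥ x) / (x ⬝ᵥ x) + (y ⬝ᵥ G.adjMatrix ℝ *ᵥ y) / (y ⬝ᵥ y))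
      ≤ G.energy := by
  have := (G.isHermitian_adjMatrix ℝ).rayleigh_add_rayleigh_le x y hxy hx hy
  rw [G.energy_eq_two_mul_sum_pos]
  linarith

theorem two_mul_add_le_energy {x y : V → ℝ} {α β : ℝ} (hαβ : α ≠ β)
    (hx : G.adjMatrix ℝ *ᵥ x = α • x) (hy : G.adjMatrix ℝ *ᵥ y = β • y)
    (hx0 : 0 < x ⬝ᵥ x) (hy0 : 0 < y ⬝ᵥ y) : 2 * (α + β) ≤ G.energy := by
  have := (G.isHermitian_adjMatrix ℝ).add_le_of_mulVec hαβ hx hy hx0 hy0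
  rw [G.energy_eq_two_mul_sum_pos]
  linarith

theorem energy_le_of_nonpos_on_hyperplane (z : V → ℝ) (ρ : ℝ) (hρ0 : 0 ≤ ρ)
    (hz : ∀ x : V → ℝ, z ⬝ᵥ x = 0 → x ⬝ᵥ G.adjMatrix ℝ *ᵥ x ≤ 0)
    (hρ : ∀ x : V → ℝ, x ⬝ᵥ G.adjMatrix ℝ *ᵥ x ≤ ρ * (x ⬝ᵥ x)) :
    G.energy ≤ 2 * ρ := by
  have := (G.isHermitian_adjMatrix ℝ).sum_pos_eigenvalues_le z ρ hρ0 hz hρ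
  rw [G.energy_eq_two_mul_sum_pos]
  linarith

theorem energy_le_two_mul_trace (N : Matrix V V ℝ) (hN : ∀ x : V → ℝ, 0 ≤ x ⬝ᵥ N *ᵥ x)
    (hAN : ∀ x : V → ℝ, 0 ≤ x ⬝ᵥ G.adjMatrix ℝ *ᵥ x + x ⬝ᵥ N *ᵥ x) :
    G.energy ≤ 2 * N.trace := by
  have := (G.isHermitian_adjMatrix ℝ).sum_pos_eigenvalues_le_trace (G.trace_adjMatrix ℝ) N hN hAN
  rw [G.energy_eq_two_mul_sum_pos]
  linarith

theorem mulVec_adjMatrix_deleteEdge {u v : V} (huv : G.Adj u v)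
    [DecidableRel (G.deleteEdges {s(u, v)}).Adj] (x : V → ℝ) (p : V) :
    ((G.deleteEdges {s(u, v)}).adjMatrix ℝ *ᵥ x) p =
      (G.adjMatrix ℝ *ᵥ x) p - (if p = u then x v else 0) - (if p = v then x u else 0) := by
  have hne : u ≠ v := huv.ne
  have key : ∀ q, (G.deleteEdges {s(u, v)}).adjMatrix ℝ p q =
      G.adjMatrix ℝ p q - (if p = u then (if q = v then 1 else 0) else 0)
        - (if p = v then (if q = u then 1 else 0) else 0) := by
    intro q
    simp only [adjMatrix_apply, deleteEdges_adj, Set.mem_singleton_iff, Sym2.eq_iff]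
    by_cases h1 : p = u
    · subst h1
      by_cases h2 : q = v
      · subst h2; simp [huv, hne]
      · simp [h2, hne]
    · by_cases h2 : p = v
      · subst h2
        by_cases h3 : q = u
        · subst h3; simp [huv.symm, hne.symm]
        · simp [h3, h1]
      · simp [h1, h2]
  simp only [mulVec, dotProduct, key, sub_mul, Finset.sum_sub_distrib]
  congr 1
  · congr 1
    by_cases h : p = u <;> simp [h]
  · by_cases h : p = v <;> simp [h]

theorem dotProduct_adjMatrix_deleteEdge {u v : V} (huv : G.Adj u v)
    [DecidableRel (G.deleteEdges {s(u, v)}).Adj] (x : V → ℝ) :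
    x ⬝ᵥ (G.deleteEdges {s(u, v)}).adjMatrix ℝ *ᵥ x =
      x ⬝ᵥ G.adjMatrix ℝ *ᵥ x - 2 * (x u * x v) := by
  simp only [dotProduct, mulVec_adjMatrix_deleteEdge huv, mul_sub, Finset.sum_sub_distrib, mul_ite,
    mul_zero, Finset.sum_ite_eq', Finset.mem_univ, if_true]
  ring

end Energy

/-! ### Complete multipartite graphs described by a colouring; their energy as `2ρ`. -/

section Coloring

variable {V ι : Type*} [Fintype V] [DecidableEq ι]

/-- The sum of `x` over the colour class `l`. -/
def classSum (c : V → ι) (x : V → ℝ) (l : ι) : ℝ := ∑ p, if c p = l then x p else 0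

/-- The size of the colour class `l`. -/
def classCard (c : V → ι) (l : ι) : ℝ := classSum c (fun _ => 1) l

theorem sum_classSum [Fintype ι] (c : V → ι) (x : V → ℝ) : ∑ l, classSum c x l = ∑ p, x p := by
  unfold classSum
  rw [Finset.sum_comm]
  simp

theorem classCard_nonneg (c : V → ι) (l : ι) : 0 ≤ classCard c l :=
  Finset.sum_nonneg fun p _ => by split_ifs <;> norm_num

theorem classSum_comp (c : V → ι) (φ : ι → ℝ) (l : ι) :
    classSum c (fun p => φ (c p)) l = classCard c l * φ l := by
  simp only [classCard, classSum, Finset.sum_mul]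
  refine Finset.sum_congr rfl fun p _ => ?_
  split_ifs with h
  · rw [h, one_mul]
  · rw [zero_mul]

theorem sum_comp_eq [Fintype ι] (c : V → ι) (φ : ι → ℝ) : ∑ p, φ (c p) = ∑ l, classCard c l * φ l := by
  rw [← sum_classSum c]
  exact Finset.sum_congr rfl fun l _ => classSum_comp c φ l

/-- Cauchy-Schwarz on every colour class. -/
theorem sq_classSum_le (c : V → ι) (x : V → ℝ) (l : ι) :
    classSum c x l ^ 2 ≤ classCard c l * classSum c (fun p => x p ^ 2) l := by
  have h := Finset.sum_mul_sq_le_sq_mul_sq Finset.univ (fun p => if c p = l then (1 : ℝ) else 0)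
    (fun p => if c p = l then x p else 0)
  simp only [classCard, classSum]
  have e1 : ∀ p, (if c p = l then (1 : ℝ) else 0) * (if c p = l then x p else 0) =
      if c p = l then x p else 0 := fun p => by split_ifs <;> simp
  have e2 : ∀ p, (if c p = l then (1 : ℝ) else 0) ^ 2 = if c p = l then 1 else 0 :=
    fun p => by split_ifs <;> simp
  have e3 : ∀ p, (if c p = l then x p else 0) ^ 2 = if c p = l then x p ^ 2 else 0 :=
    fun p => by split_ifs <;> simp
  simpa only [e1, e2, e3] using h

variable {G : SimpleGraph V} [DecidableRel G.Adj] {c : V → ι}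

theorem mulVec_adjMatrix_of_coloring (hG : ∀ p q, G.Adj p q ↔ c p ≠ c q) (x : V → ℝ) (p : V) :
    (G.adjMatrix ℝ *ᵥ x) p = ∑ q, x q - classSum c x (c p) := by
  simp only [mulVec, dotProduct, classSum, ← Finset.sum_sub_distrib]
  refine Finset.sum_congr rfl fun q _ => ?_
  simp only [adjMatrix_apply, hG]
  by_cases h : c p = c q
  · simp [h]
  · simp [h, Ne.symm h]

theorem dotProduct_adjMatrix_of_coloring [Fintype ι] (hG : ∀ p q, G.Adj p q ↔ c p ≠ c q) (x : V → ℝ) :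
    x ⬝ᵥ G.adjMatrix ℝ *ᵥ x = (∑ q, x q) ^ 2 - ∑ l, classSum c x l ^ 2 := by
  have h : ∀ p, x p * classSum c x (c p) = ∑ l, (if c p = l then x p else 0) * classSum c x l := by
    intro p
    simp
  simp only [dotProduct, mulVec_adjMatrix_of_coloring hG, mul_sub, Finset.sum_sub_distrib]
  congr 1
  · rw [← Finset.sum_mul, sq]
  · rw [Finset.sum_congr rfl fun p _ => h p, Finset.sum_comm]
    refine Finset.sum_congr rfl fun l _ => ?_
    rw [← Finset.sum_mul, sq]
    rfl

/-- The all-ones vector is normal to a hyperplane on which the form is nonpositive, so only the top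
eigenvalue needs a bound. Empty classes are allowed. -/
theorem energy_le_of_coloring [Fintype ι] (hG : ∀ p q, G.Adj p q ↔ c p ≠ c q) {ρ : ℝ} (hρ : 0 < ρ)
    (hsum : ∑ l, classCard c l / (ρ + classCard c l) ≤ 1) : G.energy ≤ 2 * ρ := by
  classical
  refine energy_le_of_nonpos_on_hyperplane (fun _ => 1) ρ hρ.le (fun x hx => ?_) fun x => ?_
  · rw [dotProduct_adjMatrix_of_coloring hG]
    have h0 : ∑ q, x q = 0 := by simpa [dotProduct] using hx
    have := Finset.sum_nonneg fun l (_ : l ∈ univ) => sq_nonneg (classSum c x l)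
    rw [h0]
    linarith
  · rw [dotProduct_adjMatrix_of_coloring hG, ← sum_classSum c]
    set n := classCard c
    set s := classSum c x with hs
    have hn : ∀ l, 0 ≤ n l := classCard_nonneg c
    have hs0 : ∀ l, s l ^ 2 ≤ n l * classSum c (fun p => x p ^ 2) l := sq_classSum_le c x
    have hxx : x ⬝ᵥ x = ∑ l, classSum c (fun p => x p ^ 2) l := by
      rw [sum_classSum]
      simp only [dotProduct, sq]
    -- Cauchy–Schwarz with weights `n l / (ρ + n l)`, whose total is the quantity assumed to be at
    -- most 1.
    have hcs : (∑ l, s l) ^ 2 ≤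
        (∑ l, n l / (ρ + n l)) * ∑ l, (s l ^ 2 + ρ * (s l ^ 2 / n l)) := by
      refine Finset.sum_sq_le_sum_mul_sum_of_sq_le_mul _ (fun l _ => ?_) (fun l _ => ?_)
        fun l _ => ?_
      · have := hn l
        positivity
      · have := hn l
        positivity
      -- For an empty class `s l = 0`, and division by zero gives 0 on both sides.
      · rcases (hn l).eq_or_lt with h | h
        · have h1 := hs0 l
          rw [← h, zero_mul] at h1
          rw [le_antisymm h1 (sq_nonneg _)]
          simp
        · refine le_of_eq ?_
          field_simp
          ring
    have hnn : 0 ≤ ∑ l, (s l ^ 2 + ρ * (s l ^ 2 / n l)) := by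
      refine Finset.sum_nonneg fun l _ => ?_
      have := hn l
      positivity
    have hle : ∑ l, s l ^ 2 / n l ≤ x ⬝ᵥ x := by
      rw [hxx]
      refine Finset.sum_le_sum fun l _ => div_le_of_le_mul₀ (hn l) ?_ ?_
      · exact Finset.sum_nonneg fun p _ => by split_ifs <;> positivity
      · rw [mul_comm]; exact hs0 l
    have h1 : (∑ l, s l) ^ 2 ≤ ∑ l, (s l ^ 2 + ρ * (s l ^ 2 / n l)) :=
      hcs.trans (mul_le_of_le_one_left hnn hsum)
    rw [Finset.sum_add_distrib, ← Finset.mul_sum] at h1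
    have h2 : ρ * ∑ l, s l ^ 2 / n l ≤ ρ * (x ⬝ᵥ x) := by gcongr
    linarith

theorem dotProduct_comp_self [Fintype ι] (c : V → ι) (φ : ι → ℝ) :
    (fun p => φ (c p)) ⬝ᵥ (fun p => φ (c p)) = ∑ l, classCard c l * φ l ^ 2 := by
  rw [← sum_comp_eq c fun l => φ l ^ 2]
  simp only [dotProduct, sq]

/-- The bound given by the test vector `1 / (ρ + n_l)`. -/
theorem exists_le_energy_of_coloring [Fintype ι] (hG : ∀ p q, G.Adj p q ↔ c p ≠ c q) {ρ : ℝ}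
    (hρ : 0 < ρ) (hsum : 0 < ∑ l, classCard c l / (ρ + classCard c l)) :
    ∃ N : ℝ, 0 < N ∧ 2 * (ρ + (∑ l, classCard c l / (ρ + classCard c l)) *
      (∑ l, classCard c l / (ρ + classCard c l) - 1) / N) ≤ G.energy := by
  classical
  set n := classCard c
  have hn : ∀ l, 0 ≤ n l := classCard_nonneg c
  have hpos : ∀ l, 0 < ρ + n l := fun l => by have := hn l; positivity
  set φ : ι → ℝ := fun l => 1 / (ρ + n l) with hφ
  set x : V → ℝ := fun p => φ (c p)
  have hS : ∑ q, x q = ∑ l, n l / (ρ + n l) := by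
    rw [sum_comp_eq c φ]
    exact Finset.sum_congr rfl fun l _ => by simp only [hφ]; ring
  have hxx : x ⬝ᵥ x = ∑ l, n l * φ l ^ 2 := dotProduct_comp_self c φ
  have hx0 : 0 < x ⬝ᵥ x := by
    obtain ⟨l, -, hl⟩ := Finset.exists_ne_zero_of_sum_ne_zero hsum.ne'
    rw [hxx]
    have hl0 : 0 < n l := (hn l).lt_of_ne' fun h => hl (by rw [h, zero_div])
    refine Finset.sum_pos' (fun l _ => mul_nonneg (hn l) (sq_nonneg _)) ⟨l, mem_univ l, ?_⟩
    have := hpos l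
    positivity
  have hcl : ∑ l, classSum c x l ^ 2 = ∑ l, n l / (ρ + n l) - ρ * (x ⬝ᵥ x) := by
    rw [hxx, Finset.mul_sum, ← Finset.sum_sub_distrib]
    refine Finset.sum_congr rfl fun l _ => ?_
    rw [show classSum c x l = n l * φ l from classSum_comp c φ l]
    simp only [hφ]
    have := (hpos l).ne'
    field_simp
    ring
  refine ⟨x ⬝ᵥ x, hx0, le_of_eq_of_le ?_ (two_mul_rayleigh_le_energy x hx0)⟩
  rw [dotProduct_adjMatrix_of_coloring hG, hS, hcl]
  field_simp
  ring

theorem lt_energy_of_coloring [Fintype ι] (hG : ∀ p q, G.Adj p q ↔ c p ≠ c q) {ρ : ℝ} (hρ : 0 < ρ)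
    (hsum : 1 < ∑ l, classCard c l / (ρ + classCard c l)) : 2 * ρ < G.energy := by
  obtain ⟨N, hN, h⟩ := exists_le_energy_of_coloring hG hρ (zero_lt_one.trans hsum)
  have := div_pos (mul_pos (zero_lt_one.trans hsum) (sub_pos.mpr hsum)) hN
  linarith

theorem le_energy_of_coloring [Fintype ι] (hG : ∀ p q, G.Adj p q ↔ c p ≠ c q) {ρ : ℝ} (hρ : 0 < ρ)
    (hsum : ∑ l, classCard c l / (ρ + classCard c l) = 1) : 2 * ρ ≤ G.energy := by
  obtain ⟨N, hN, h⟩ := exists_le_energy_of_coloring hG hρ (hsum ▸ zero_lt_one)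
  simpa [hsum] using h

/-- Intermediate values on `[1, ∑ n l]`: at 1 the two distinguished classes contribute at least 1/2
each, while at the right end every denominator is at least the total. -/
theorem exists_sum_div_add_eq_one {ι : Type*} [Fintype ι] [DecidableEq ι] {n : ι → ℝ}
    (hn : ∀ l, 0 ≤ n l) {i j : ι} (hij : i ≠ j)
    (hi : 1 ≤ n i) (hj : 1 ≤ n j) : ∃ ρ : ℝ, 1 ≤ ρ ∧ ∑ l, n l / (ρ + n l) = 1 := by
  set N := ∑ l, n l with hN
  have h2 : ∀ f : ι → ℝ, (∀ l, 0 ≤ f l) → f i + f j ≤ ∑ l, f l := by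
    intro f hf
    rw [← Finset.sum_pair hij]
    exact Finset.sum_le_sum_of_subset_of_nonneg (Finset.subset_univ _) fun l _ _ => hf l
  have hN1 : 1 ≤ N := by linarith [h2 n hn]
  have hcont : ContinuousOn (fun ρ : ℝ => ∑ l, n l / (ρ + n l)) (Set.Icc 1 N) := by
    refine continuousOn_finsetSum _ fun l _ => ?_
    refine continuousOn_const.div (by fun_prop) fun x hx => ?_
    have := hn l
    have := hx.1
    positivity
  have hlow : 1 ≤ ∑ l, n l / (1 + n l) := by
    refine le_trans ?_ (h2 (fun l => n l / (1 + n l)) fun l => by have := hn l; positivity)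
    have half : ∀ a : ℝ, 1 ≤ a → 1 / 2 ≤ a / (1 + a) := fun a ha => by
      rw [div_le_div_iff₀ (by norm_num) (by linarith)]; linarith
    linarith [half _ hi, half _ hj]
  have hup : ∑ l, n l / (N + n l) ≤ 1 := by
    calc ∑ l, n l / (N + n l) ≤ ∑ l, n l / N := by
          refine Finset.sum_le_sum fun l _ => ?_
          have := hn l
          gcongr
          linarith
      _ = 1 := by rw [← Finset.sum_div, ← hN, div_self (by positivity)]
  obtain ⟨ρ, hρ, h⟩ := intermediate_value_Icc' hN1 hcont ⟨hup, hlow⟩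
  exact ⟨ρ, hρ.1, h⟩

end Coloring

/-! ### Two roots of the secular equation with large sum. -/

section Secular

/-- The cubic that governs the secular equation of a complete multipartite graph with a part of
size `1` and a part of size `c + 1`, after an edge between these two parts has been deleted. -/
def secularCubic (c x : ℝ) : ℝ := x ^ 3 + (c + 2) * x ^ 2 + c * x - c

/-- The first factor is invariant under `x ↦ a - x` and negative at the root `μ`, because `δ > 0`.
The second factor is larger at `a - μ` than at `μ`, so the reflected value is negative. -/
theorem exists_quartic_root_reflect_neg {a κ π ρ δ : ℝ} (ha : 2 < a) (hκ : 0 < κ) (hρ : 0 < ρ)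
    (hδ : 0 < δ) (h0 : 0 < π * ρ + δ) (h1 : (1 - a + π) * (1 + κ + ρ) + δ < 0) :
    ∃ μ : ℝ, 0 < μ ∧ μ < 1 ∧ (μ ^ 2 - a * μ + π) * (μ ^ 2 + κ * μ + ρ) + δ = 0 ∧
      ((a - μ) ^ 2 - a * (a - μ) + π) * ((a - μ) ^ 2 + κ * (a - μ) + ρ) + δ < 0 := by
  have hcont : ContinuousOn
      (fun x : ℝ => (x ^ 2 - a * x + π) * (x ^ 2 + κ * x + ρ) + δ) (Set.Icc 0 1) := by
    fun_prop
  obtain ⟨μ, ⟨hμ0, hμ1⟩, hμ⟩ := intermediate_value_Ioo' zero_le_one hcont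
    (show (0 : ℝ) ∈ Set.Ioo _ _ from ⟨by simpa using h1, by simpa using h0⟩)
  simp only at hμ
  refine ⟨μ, hμ0, hμ1, hμ, ?_⟩
  have hpos : 0 < μ ^ 2 + κ * μ + ρ := by positivity
  have hneg : μ ^ 2 - a * μ + π < 0 := by
    by_contra! h
    have := mul_nonneg h hpos.le
    linarith
  have hgap : 0 < (a - 2 * μ) * (a + κ) := mul_pos (by linarith) (by linarith)
  have e : ((a - μ) ^ 2 - a * (a - μ) + π) * ((a - μ) ^ 2 + κ * (a - μ) + ρ) + δ =
      (μ ^ 2 - a * μ + π) * ((a - 2 * μ) * (a + κ)) := by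
    linear_combination hμ
  rw [e]
  exact mul_neg_of_neg_of_pos hneg hgap

theorem secularCubic_pos {c x : ℝ} (hc : 0 ≤ c) (hx : 1 ≤ x) : 0 < secularCubic c x := by
  unfold secularCubic
  have h3 : (1 : ℝ) ≤ x ^ 3 := one_le_pow₀ hx
  nlinarith [mul_nonneg hc (sub_nonneg.mpr hx), sq_nonneg x]

variable {ι : Type*} {T : Finset ι} {t : ι → ℝ}

theorem continuousOn_sum_div_add (ht : ∀ l ∈ T, 1 ≤ t l) {a b : ℝ} (ha : 0 ≤ a) :
    ContinuousOn (fun x : ℝ => ∑ l ∈ T, t l / (x + t l)) (Set.Icc a b) := by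
  refine continuousOn_finsetSum _ fun l hl => ?_
  refine continuousOn_const.div (by fun_prop) fun x hx => ?_
  have h1 := ht l hl
  have h2 := hx.1
  exact (by linarith : 0 < x + t l).ne'

theorem sum_div_add_pos (hT : T.Nonempty) (ht : ∀ l ∈ T, 1 ≤ t l) {x : ℝ} (hx : 0 ≤ x) :
    0 < ∑ l ∈ T, t l / (x + t l) := by
  refine Finset.sum_pos (fun l hl => ?_) hT
  have := ht l hl
  positivity

/-- In the variable `φ = s / (a + s)`, the function `s / (x + s)` becomes a Möbius function
vanishing at 0, concave when `x ≤ a`. -/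
theorem mobius_div_add {a x s : ℝ} (ha : 0 < a) (hx : 0 < x) (hs : 0 ≤ s) :
    a * (s / (a + s)) / (x + (a - x) * (s / (a + s))) = s / (x + s) := by
  have h : x + (a - x) * (s / (a + s)) = a * (x + s) / (a + s) := by
    field_simp
    ring
  rw [h]
  field_simp

/-- Subadditivity of that concave function: merging all parts into one, with the value at `a` kept
fixed, only lowers the sum on `(0, a]`. -/
theorem le_sum_div_add (ht : ∀ l ∈ T, 1 ≤ t l) {a x : ℝ} (hx : 0 < x) (hxa : x ≤ a) :
    a * (∑ l ∈ T, t l / (a + t l)) / (x + (a - x) * ∑ l ∈ T, t l / (a + t l)) ≤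
      ∑ l ∈ T, t l / (x + t l) := by
  have ha : 0 < a := hx.trans_le hxa
  rw [Finset.mul_sum, Finset.sum_div]
  refine Finset.sum_le_sum fun l hl => ?_
  have h1 := ht l hl
  have h2 : t l / (a + t l) ≤ ∑ l ∈ T, t l / (a + t l) := Finset.single_le_sum
    (f := fun l => t l / (a + t l)) (fun m hm => by have := ht m hm; positivity) hl
  have h3 : (a - x) * (t l / (a + t l)) ≤ (a - x) * ∑ l ∈ T, t l / (a + t l) :=
    mul_le_mul_of_nonneg_left h2 (by linarith)
  have h4 : 0 ≤ (a - x) * (t l / (a + t l)) := mul_nonneg (by linarith) (by positivity)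
  rw [← mobius_div_add ha hx (by linarith : 0 ≤ t l)]
  gcongr

/-- A four-point inequality for the concave function `φ ↦ a * φ / (x + k * φ)`. -/
theorem mobius_four_point {a x k p q r w : ℝ} (hx : 0 < x) (hk : 0 ≤ k) (ha : 0 ≤ a) (hw : 0 ≤ w)
    (hp : w ≤ p) (hq : w ≤ q) (h : p + q = w + r) :
    a * w / (x + k * w) + a * r / (x + k * r) ≤ a * p / (x + k * p) + a * q / (x + k * q) := by
  have hp0 : 0 ≤ p := hw.trans hp
  have hq0 : 0 ≤ q := hw.trans hq
  have hr0 : 0 ≤ r := by linarith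
  have e1 : a * p / (x + k * p) - a * w / (x + k * w) =
      a * x * (p - w) / ((x + k * p) * (x + k * w)) := by
    field_simp
    ring
  have e2 : a * r / (x + k * r) - a * q / (x + k * q) =
      a * x * (p - w) / ((x + k * r) * (x + k * q)) := by
    rw [show p - w = r - q by linarith]
    field_simp
    ring
  have h1 : a * x * (p - w) / ((x + k * r) * (x + k * q)) ≤
      a * x * (p - w) / ((x + k * p) * (x + k * w)) := by
    have h2 : 0 ≤ a * x * (p - w) := mul_nonneg (by positivity) (by linarith)
    have h3 : p ≤ r := by linarith
    gcongr
  linarith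

/-- A lower bound `g` of `h x = ∑ t_l / (x + t_l)` whose own secular equation has a root `μ < 1`
that becomes subcritical under `μ ↦ a - μ` forces two roots of the secular equation of `h`
with sum greater than `a`. -/
theorem exists_secular_roots (hT : T.Nonempty) (ht : ∀ l ∈ T, 1 ≤ t l) {c a : ℝ} (hc : 1 ≤ c)
    (ha : 2 < a) (hsum : ∑ l ∈ T, t l / (a + t l) = (a ^ 2 - (c + 1)) / ((a + 1) * (a + (c + 1))))
    {g : ℝ → ℝ} (hg : ∀ x, 0 < x → x ≤ a → g x ≤ ∑ l ∈ T, t l / (x + t l))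
    {μ : ℝ} (hμ0 : 0 < μ) (hμ1 : μ < 1) (hμ : g μ * secularCubic c μ = μ * (μ ^ 2 - c))
    (hμ0' : 0 < g μ)
    (hν : (a - μ) * ((a - μ) ^ 2 - c) < g (a - μ) * secularCubic c (a - μ)) :
    ∃ x y : ℝ, 0 < x ∧ x < y ∧ a < x + y ∧
      (∑ l ∈ T, t l / (x + t l)) * secularCubic c x = x * (x ^ 2 - c) ∧
      (∑ l ∈ T, t l / (y + t l)) * secularCubic c y = y * (y ^ 2 - c) := by
  set h : ℝ → ℝ := fun x => ∑ l ∈ T, t l / (x + t l) with hh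
  -- The secular roots are the zeros of `p`. Its signs at `μ`, `1`, `a - μ`, `a` are `≥ 0`, `< 0`,
  -- `< 0`, `> 0`, which puts one zero in `[μ, 1)` and one in `(a - μ, a)`.
  set p : ℝ → ℝ := fun x => x * (x ^ 2 - c) - h x * secularCubic c x with hp
  have hcont : ∀ s r : ℝ, 0 ≤ s → ContinuousOn p (Set.Icc s r) := by
    intro s r hs
    refine ContinuousOn.sub (by fun_prop) ((continuousOn_sum_div_add ht hs).mul ?_)
    unfold secularCubic
    fun_prop
  have hpμ : 0 ≤ p μ := by
    have h1 : μ * (μ ^ 2 - c) < 0 := mul_neg_of_pos_of_neg hμ0 (by nlinarith)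
    -- The cubic is negative at `μ` but positive from 1 on, so the single bound `g ≤ h` gives the
    -- wanted sign of `p` at both `μ` and `a - μ`.
    have h2 : secularCubic c μ < 0 := by
      by_contra! hcon
      have := mul_nonneg hμ0'.le hcon
      linarith
    have h3 := mul_le_mul_of_nonpos_right (hg μ hμ0 (by linarith)) h2.le
    simp only [hp, hh]
    linarith
  have hp1 : p 1 < 0 := by
    have h1 : 0 < h 1 := sum_div_add_pos hT ht zero_le_one
    have h2 := mul_pos h1 (secularCubic_pos (by linarith : (0 : ℝ) ≤ c) le_rfl)
    simp only [hp]
    nlinarith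
  have hpν : p (a - μ) < 0 := by
    have h1 := mul_le_mul_of_nonneg_right (hg (a - μ) (by linarith) (by linarith))
      (secularCubic_pos (by linarith : (0 : ℝ) ≤ c) (by linarith : 1 ≤ a - μ)).le
    simp only [hp, hh]
    linarith
  have hpa : 0 < p a := by
    have h0 : 0 < h a := sum_div_add_pos hT ht (by linarith)
    have hb : 0 < (a + 1) * (a + (c + 1)) := by positivity
    have h1 : c + 1 < a ^ 2 := by
      have : 0 < (a ^ 2 - (c + 1)) / ((a + 1) * (a + (c + 1))) := hsum ▸ h0
      have := (div_pos_iff_of_pos_right hb).mp this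
      linarith
    have e : p a * ((a + 1) * (a + (c + 1))) = 2 * a ^ 3 + (c + 1) * (2 * a ^ 2 - c) := by
      simp only [hp, hh, hsum, secularCubic]
      field_simp
      ring
    have h2 : 0 < 2 * a ^ 3 + (c + 1) * (2 * a ^ 2 - c) := by
      have : 0 < 2 * a ^ 2 - c := by linarith
      positivity
    rw [← e] at h2
    exact (pos_iff_pos_of_mul_pos h2).mpr hb
  obtain ⟨x, hx, hxp⟩ := intermediate_value_Icc' hμ1.le (hcont μ 1 hμ0.le) ⟨hp1.le, hpμ⟩
  have hx1 : x < 1 := hx.2.lt_of_ne fun h => by rw [h] at hxp; linarith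
  obtain ⟨y, hy, hyp⟩ := intermediate_value_Ioo (by linarith : a - μ ≤ a)
    (hcont (a - μ) a (by linarith)) ⟨hpν, hpa⟩
  refine ⟨x, y, hμ0.trans_le hx.1, by linarith [hy.1], by linarith [hx.1, hy.1], ?_, ?_⟩
  · simp only [hp] at hxp; linarith
  · simp only [hp] at hyp; linarith

theorem exists_secular_roots_of_two_le (hT : T.Nonempty) (ht : ∀ l ∈ T, 1 ≤ t l) {c a : ℝ}
    (hc : 2 ≤ c) (ha0 : 0 < a)
    (hsum : ∑ l ∈ T, t l / (a + t l) = (a ^ 2 - (c + 1)) / ((a + 1) * (a + (c + 1)))) :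
    ∃ x y : ℝ, 0 < x ∧ x < y ∧ a < x + y ∧
      (∑ l ∈ T, t l / (x + t l)) * secularCubic c x = x * (x ^ 2 - c) ∧
      (∑ l ∈ T, t l / (y + t l)) * secularCubic c y = y * (y ^ 2 - c) := by
  have hden : 0 < (c + 2) * a + 2 * (c + 1) := by positivity
  -- The size of a single part giving the same value at `a`, that is, the solution of `τ / (a + τ) =
  -- ∑ t l / (a + t l)`.
  obtain ⟨τ, hτ⟩ : ∃ τ, τ = a * (a ^ 2 - (c + 1)) / ((c + 2) * a + 2 * (c + 1)) := ⟨_, rfl⟩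
  have hcub : a * (a ^ 2 - (c + 1)) = τ * ((c + 2) * a + 2 * (c + 1)) := by
    rw [hτ]; field_simp
  have hQ1 : 1 / (a + 1) ≤ ∑ l ∈ T, t l / (a + t l) := by
    obtain ⟨l, hl⟩ := hT
    have h1 := ht l hl
    calc 1 / (a + 1) ≤ t l / (a + t l) := by
          rw [div_le_div_iff₀ (by positivity) (by positivity)]
          nlinarith
      _ ≤ _ := Finset.single_le_sum (f := fun l => t l / (a + t l))
          (fun m hm => by have := ht m hm; positivity) hl
  have hτ1 : 1 ≤ τ := by
    rw [hsum, div_le_div_iff₀ (by positivity) (by positivity)] at hQ1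
    rw [hτ, le_div_iff₀ hden]
    nlinarith
  have hQ : ∑ l ∈ T, t l / (a + t l) = τ / (a + τ) := by
    rw [hsum, div_eq_div_iff (by positivity) (by positivity)]
    linear_combination hcub
  have hA : a * (a ^ 2 - c - (c + 2) * τ) = a + 2 * (c + 1) * τ := by linear_combination hcub
  have hA' : a ^ 2 - c - (c + 2) * τ = 1 + 2 * (c + 1) * τ / a := by
    field_simp; linear_combination hA
  have hA0 : 0 < 2 * (c + 1) * τ / a := by positivity
  have hsq : (c + 1) + (c + 2) * τ < a ^ 2 := by linarith
  have ha : 2 < a := by nlinarith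
  -- This is `δ > 0` for the factorization below, multiplied by `4 a²`. The coefficient `4c² - c -
  -- 6` in `hF` is positive for `c ≥ 2` but negative at `c = 1`.
  have hψ : 4 * (c + 1) * τ * a + 4 * (2 * c + 1) * τ ^ 2 < a ^ 2 * (4 * c * τ - 1) := by
    have hF : 0 < (4 * c ^ 2 - c - 6) * a ^ 2 + (c + 1) * (4 * c - 10) * a - 4 * (c + 1) := by
      have h1 : 0 ≤ (4 * c ^ 2 - c - 6) * (a * (a - 2)) :=
        mul_nonneg (by nlinarith) (mul_nonneg ha0.le (by linarith))
      have h2 : 0 ≤ (12 * c ^ 2 - 8 * c - 22) * (a - 2) :=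
        mul_nonneg (by nlinarith) (by linarith)
      nlinarith
    have e : ((4 * c - 1) * a ^ 2 - 4 * (c + 1) * a - 4 * (2 * c + 1) * τ) *
        ((c + 2) * a + 2 * (c + 1)) =
        a * ((4 * c ^ 2 - c - 6) * a ^ 2 + (c + 1) * (4 * c - 10) * a - 4 * (c + 1)) := by
      linear_combination 4 * (2 * c + 1) * hcub
    have h1 : 0 < (4 * c - 1) * a ^ 2 - 4 * (c + 1) * a - 4 * (2 * c + 1) * τ :=
      (pos_iff_pos_of_mul_pos (e ▸ mul_pos ha0 hF)).mpr hden
    have h2 := mul_pos (by linarith : 0 < τ) h1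
    nlinarith [mul_nonneg (sub_nonneg.mpr hτ1) (sq_nonneg a)]
  have hg : ∀ x, 0 < x → x ≤ a → τ / (x + τ) ≤ ∑ l ∈ T, t l / (x + t l) := by
    intro x hx hxa
    have h1 := le_sum_div_add ht hx hxa
    rwa [hQ, mobius_div_add ha0 hx (by linarith)] at h1
  -- `π` and `ρ` are forced by matching the coefficients of `x²` and `x` in `hfac`; the absence of a
  -- cubic term forces `κ = a`.
  obtain ⟨π, hπ⟩ : ∃ π, π = (1 + 2 * τ / a) / 2 := ⟨_, rfl⟩
  obtain ⟨ρ, hρ⟩ : ∃ ρ, ρ = (1 + (4 * c + 2) * τ / a) / 2 := ⟨_, rfl⟩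
  have hδ : 0 < c * τ - π * ρ := by
    have e : (c * τ - π * ρ) * (4 * a ^ 2) =
        a ^ 2 * (4 * c * τ - 1) - (4 * (c + 1) * τ * a + 4 * (2 * c + 1) * τ ^ 2) := by
      rw [hπ, hρ]
      field_simp
      ring
    have h2 : 0 < (c * τ - π * ρ) * (4 * a ^ 2) := by linarith
    exact (pos_iff_pos_of_mul_pos h2).mpr (by positivity)
  have hfac : ∀ x, (x ^ 2 - a * x + π) * (x ^ 2 + a * x + ρ) + (c * τ - π * ρ) =
      x ^ 4 - (c + (c + 2) * τ) * x ^ 2 - 2 * c * τ * x + c * τ := by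
    intro x
    have e1 : π + ρ = a ^ 2 - c - (c + 2) * τ := by rw [hA', hπ, hρ]; ring
    have e2 : a * (ρ - π) = 2 * c * τ := by rw [hπ, hρ]; field_simp; ring
    linear_combination x ^ 2 * e1 - x * e2
  obtain ⟨μ, hμ0, hμ1, hμ, hν⟩ := exists_quartic_root_reflect_neg (a := a) (κ := a) (π := π) (ρ := ρ)
    (δ := c * τ - π * ρ) ha ha0 (by rw [hρ]; positivity) hδ (by nlinarith) (by
      have := hfac 1
      simp only [one_pow, mul_one] at this
      rw [this]
      nlinarith)
  rw [hfac] at hμ hν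
  refine exists_secular_roots hT ht (by linarith) ha hsum hg hμ0 hμ1 ?_ (by positivity) ?_
  · rw [div_mul_eq_mul_div, div_eq_iff (by positivity), secularCubic]
    linear_combination (-1 : ℝ) * hμ
  · have : 0 < a - μ + τ := by linarith
    rw [div_mul_eq_mul_div, lt_div_iff₀ this, secularCubic]
    linear_combination hν

/-- With a single remaining part the energy drops when `c = 1`, so the comparison must retain two
parts. They are spread apart to sizes 1 and `τ` by `mobius_four_point`, keeping the value at `a`. -/
theorem exists_secular_roots_of_one (ht : ∀ l ∈ T, 1 ≤ t l) {i j : ι} (hi : i ∈ T) (hj : j ∈ T)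
    (hij : i ≠ j) {a : ℝ} (ha0 : 0 < a)
    (hsum : ∑ l ∈ T, t l / (a + t l) = (a ^ 2 - (1 + 1)) / ((a + 1) * (a + (1 + 1)))) :
    ∃ x y : ℝ, 0 < x ∧ x < y ∧ a < x + y ∧
      (∑ l ∈ T, t l / (x + t l)) * secularCubic 1 x = x * (x ^ 2 - 1) ∧
      (∑ l ∈ T, t l / (y + t l)) * secularCubic 1 y = y * (y ^ 2 - 1) := by
  have hden : 0 < 4 * a + 6 := by positivity
  obtain ⟨τ, hτ⟩ : ∃ τ, τ = a * (a ^ 2 - a - 4) / (4 * a + 6) := ⟨_, rfl⟩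
  have hcub : a * (a ^ 2 - a - 4) = τ * (4 * a + 6) := by
    rw [hτ]; field_simp
  classical
  have hφ : ∀ l ∈ T, 1 / (a + 1) ≤ t l / (a + t l) := by
    intro l hl
    have h1 := ht l hl
    rw [div_le_div_iff₀ (by positivity) (by positivity)]
    nlinarith
  have hsplit : ∀ x : ℝ, ∑ l ∈ T, t l / (x + t l) =
      t i / (x + t i) + ∑ l ∈ T.erase i, t l / (x + t l) := fun x =>
    (Finset.add_sum_erase T (fun l => t l / (x + t l)) hi).symm
  have ht' : ∀ l ∈ T.erase i, 1 ≤ t l := fun l hl => ht l (Finset.mem_of_mem_erase hl)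
  have hR : 1 / (a + 1) ≤ ∑ l ∈ T.erase i, t l / (a + t l) :=
    (hφ j hj).trans (Finset.single_le_sum (f := fun l => t l / (a + t l))
      (fun m hm => by have := ht' m hm; positivity) (Finset.mem_erase.mpr ⟨hij.symm, hj⟩))
  have hτ1 : 1 ≤ τ := by
    have h2 : 1 / (a + 1) + 1 / (a + 1) ≤ ∑ l ∈ T, t l / (a + t l) := by
      rw [hsplit]
      exact add_le_add (hφ i hi) hR
    rw [hsum, ← add_div, div_le_div_iff₀ (by positivity) (by positivity)] at h2
    rw [hτ, le_div_iff₀ hden]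
    have h3 : (a + 1) * ((1 + 1) * (a + (1 + 1))) ≤ (a + 1) * (a ^ 2 - (1 + 1)) := by linarith
    have h4 := le_of_mul_le_mul_left h3 (by positivity)
    nlinarith
  have hQ : ∑ l ∈ T, t l / (a + t l) = 1 / (a + 1) + τ / (a + τ) := by
    rw [hsum, div_add_div _ _ (by positivity) (by positivity),
      div_eq_div_iff (by positivity) (by positivity)]
    linear_combination (a + 1) * hcub
  have ha : 7 / 2 < a := by
    have h1 : 4 * a + 6 ≤ a * (a ^ 2 - a - 4) := by
      rw [hcub]
      exact le_mul_of_one_le_left hden.le hτ1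
    have h2 : 0 ≤ (a + 1) * (a ^ 2 - 2 * a - 6) := by linarith
    have h3 := nonneg_of_mul_nonneg_right h2 (by linarith)
    nlinarith
  have hg : ∀ x, 0 < x → x ≤ a → 1 / (x + 1) + τ / (x + τ) ≤ ∑ l ∈ T, t l / (x + t l) := by
    intro x hx hxa
    have h1 := le_sum_div_add ht' hx hxa
    have h3 := mobius_four_point hx (sub_nonneg.mpr hxa) ha0.le (by positivity : 0 ≤ 1 / (a + 1))
      (hφ i hi) hR (hsplit a ▸ hQ)
    rw [mobius_div_add ha0 hx zero_le_one, mobius_div_add ha0 hx (by linarith),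
      mobius_div_add ha0 hx (by linarith [ht i hi])] at h3
    rw [hsplit x]
    linarith
  -- Coefficient matching again. After the factor `x + 1` is removed the quartic has cubic term
  -- `-x³`, hence `κ = a - 1`.
  obtain ⟨π, hπ⟩ : ∃ π, π = (a + 1 + 2 * τ) / (2 * a - 1) := ⟨_, rfl⟩
  obtain ⟨ρ, hρ⟩ : ∃ ρ, ρ = 1 + 6 * τ / a - π := ⟨_, rfl⟩
  have ha1 : 0 < 2 * a - 1 := by linarith
  have hρ0 : 0 < ρ := by
    have e : ρ * (a * (2 * a - 1)) = a ^ 2 - 2 * a + (10 * a - 6) * τ := by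
      have e2 : (2 * a - 1) * π = a + 1 + 2 * τ := by rw [hπ]; field_simp
      rw [hρ]
      field_simp
      linear_combination (-a) * e2
    have h2 : 0 < ρ * (a * (2 * a - 1)) := by
      rw [e]
      nlinarith
    exact (pos_iff_pos_of_mul_pos h2).mpr (by positivity)
  have hδ : 0 < 2 * τ - π * ρ := by
    have e2 : (2 * a - 1) * π = a + 1 + 2 * τ := by rw [hπ]; field_simp
    have e3 : a * ρ = a + 6 * τ - a * π := by rw [hρ]; field_simp
    have e4 : (2 * a + 3) * (a + 1 + 2 * τ) = a ^ 3 + a ^ 2 + a + 3 := by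
      linear_combination -hcub
    have e5 : (2 * a + 3) * (a * (2 * a - 1) * ρ) = a * (5 * a ^ 3 - 6 * a ^ 2 - 18 * a + 6) := by
      linear_combination (2 * a + 3) * (2 * a - 1) * e3 - (2 * a + 3) * a * e2
        - (5 * a - 3) * hcub
    have e : (2 * τ - π * ρ) * ((2 * a + 3) ^ 2 * (2 * a - 1) ^ 2 * a) =
        a * (a * (a ^ 2 - a - 4) * (2 * a - 1) ^ 2 * (2 * a + 3) -
          (a ^ 3 + a ^ 2 + a + 3) * (5 * a ^ 3 - 6 * a ^ 2 - 18 * a + 6)) := by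
      have e6 : (2 * a + 3) * ((2 * a - 1) * π) = a ^ 3 + a ^ 2 + a + 3 := by rw [e2, e4]
      have e7 : (2 * a + 3) ^ 2 * (2 * a - 1) ^ 2 * a * (π * ρ) =
          (a ^ 3 + a ^ 2 + a + 3) * (a * (5 * a ^ 3 - 6 * a ^ 2 - 18 * a + 6)) := by
        rw [← e6, ← e5]; ring
      linear_combination -e7 - (2 * a + 3) * (2 * a - 1) ^ 2 * a * hcub
    have hF : 0 < a * (a ^ 2 - a - 4) * (2 * a - 1) ^ 2 * (2 * a + 3) -
        (a ^ 3 + a ^ 2 + a + 3) * (5 * a ^ 3 - 6 * a ^ 2 - 18 * a + 6) := by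
      -- Expanded around 7/2, a lower bound for `a`, the polynomial has only positive coefficients.
      obtain ⟨s, hs⟩ : ∃ s, s = a - 7 / 2 := ⟨_, rfl⟩
      have hs0 : 0 < s := by linarith
      rw [show a = s + 7 / 2 by linarith]
      ring_nf
      positivity
    exact (pos_iff_pos_of_mul_pos (e ▸ mul_pos ha0 hF)).mpr (by positivity)
  have hfac : ∀ x, (x ^ 2 - a * x + π) * (x ^ 2 + (a - 1) * x + ρ) + (2 * τ - π * ρ) =
      x ^ 4 - x ^ 3 - (4 * τ + 3) * x ^ 2 - (4 * τ - 1) * x + 2 * τ := by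
    intro x
    have e1 : π + ρ = a ^ 2 - a - 4 * τ - 3 := by
      rw [hρ]
      field_simp
      linear_combination -hcub
    have e2 : (2 * a - 1) * π = a + 1 + 2 * τ := by rw [hπ]; field_simp
    have e3 : a * (π + ρ) = a + 6 * τ := by rw [hρ]; field_simp; ring
    linear_combination x ^ 2 * e1 - x * e3 + x * e2
  obtain ⟨μ, hμ0, hμ1, hμ, hν⟩ := exists_quartic_root_reflect_neg (a := a) (κ := a - 1) (π := π) (ρ := ρ)
    (δ := 2 * τ - π * ρ) (by linarith) (by linarith) hρ0 hδ (by linarith) (by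
      have := hfac 1
      simp only [one_pow, mul_one] at this
      rw [this]
      linarith)
  rw [hfac] at hμ hν
  refine exists_secular_roots ⟨i, hi⟩ ht le_rfl (by linarith) hsum hg hμ0 hμ1 ?_
    (by positivity) ?_
  · rw [div_add_div _ _ (by positivity) (by positivity), div_mul_eq_mul_div,
      div_eq_iff (by positivity), secularCubic]
    linear_combination (-(μ + 1)) * hμ
  · have h1 : 0 < a - μ + τ := by linarith
    have h2 : 0 < a - μ + 1 := by linarith
    rw [div_add_div _ _ h2.ne' h1.ne', div_mul_eq_mul_div, lt_div_iff₀ (by positivity),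
      secularCubic]
    have h3 := mul_neg_of_pos_of_neg h2 hν
    linear_combination h3

end Secular

/-! ### Deletions that increase the energy. -/

section DeleteEdge

variable {V ι : Type*} [Fintype V] [DecidableEq V] [DecidableEq ι]

theorem classSum_eq_of_unique {c : V → ι} {i : ι} {u : V} (hu : ∀ p, c p = i ↔ p = u)
    (x : V → ℝ) : classSum c x i = x u := by
  simp [classSum, hu]

theorem classCard_eq_one_of_unique {c : V → ι} {i : ι} {u : V} (hu : ∀ p, c p = i ↔ p = u) :
    classCard c i = 1 := classSum_eq_of_unique hu _

theorem sum_univ_of_two [Fintype ι] {i j : ι} (hij : i ≠ j) (hι : ∀ m, m = i ∨ m = j)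
    (f : ι → ℝ) : ∑ m, f m = f i + f j := by
  rw [← Finset.sum_pair hij]
  congr 1
  ext m
  simpa using hι m

theorem sum_univ_of_three [Fintype ι] {i j l : ι} (hij : i ≠ j) (hil : i ≠ l) (hjl : j ≠ l)
    (hι : ∀ m, m = i ∨ m = j ∨ m = l) (f : ι → ℝ) : ∑ m, f m = f i + (f j + f l) := by
  rw [← Finset.sum_pair hjl, ← Finset.sum_insert (by simp [hij, hil])]
  congr 1
  ext m
  simpa using hι m

/-- A class function modified at two vertices. -/
def modClass (c : V → ι) (φ : ι → ℝ) (u : V) (α : ℝ) (v : V) (β : ℝ) (p : V) : ℝ :=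
  φ (c p) + (if p = u then α else 0) + (if p = v then β else 0)

theorem classSum_modClass (c : V → ι) (φ : ι → ℝ) (u : V) (α : ℝ) (v : V) (β : ℝ) (l : ι) :
    classSum c (modClass c φ u α v β) l =
      classCard c l * φ l + (if c u = l then α else 0) + (if c v = l then β else 0) := by
  rw [← classSum_comp]
  simp only [classSum, modClass]
  have h : ∀ p, (if c p = l then φ (c p) + (if p = u then α else 0) + (if p = v then β else 0)
      else 0) = (if c p = l then φ (c p) else 0) +
      (if p = u then (if c u = l then α else 0) else 0) +
      (if p = v then (if c v = l then β else 0) else 0) := by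
    intro p
    by_cases h1 : p = u <;> by_cases h2 : p = v <;> by_cases h3 : c p = l <;> simp_all
  simp only [h, Finset.sum_add_distrib, Finset.sum_ite_eq', Finset.mem_univ, if_true]

theorem modClass_dotProduct [Fintype ι] (c : V → ι) (φ : ι → ℝ) (u : V) (α : ℝ) (v : V) (β : ℝ)
    (y : V → ℝ) :
    modClass c φ u α v β ⬝ᵥ y = ∑ l, φ l * classSum c y l + α * y u + β * y v := by
  have h : ∑ p, φ (c p) * y p = ∑ l, φ l * classSum c y l := by
    rw [← sum_classSum c]
    refine Finset.sum_congr rfl fun l _ => ?_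
    simp only [classSum, Finset.mul_sum]
    refine Finset.sum_congr rfl fun p _ => ?_
    split_ifs with h
    · rw [h]
    · rw [mul_zero]
  simp [dotProduct, modClass, add_mul, Finset.sum_add_distrib, h]

variable {G : SimpleGraph V} [DecidableRel G.Adj] {c : V → ι} {u v : V} {i j : ι}

/-- The Perron vector `x` of `G` drops below `ρ` by `2 φ i φ j / (x ⬝ᵥ x) < 1/2`, and `hstrict` is
what makes this strict. The vector `y` has form 0 on `G` and rises to at least 1/2, with equality
for sizes 2 and 2. -/
theorem energy_lt_deleteEdge_of_two_le [Fintype ι] (hG : ∀ p q, G.Adj p q ↔ c p ≠ c q)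
    (hu : c u = i) (hv : c v = j) (hij : i ≠ j) (hi : 2 ≤ classCard c i) (hj : 2 ≤ classCard c j)
    (hstrict : 2 < classCard c i ∨ 2 < classCard c j ∨ ∃ l, l ≠ i ∧ l ≠ j ∧ 1 ≤ classCard c l) :
    G.energy < (G.deleteEdges {s(u, v)}).energy := by
  classical
  have huv : G.Adj u v := by rw [hG, hu, hv]; exact hij
  obtain ⟨ρ, hρ1, hρ⟩ := exists_sum_div_add_eq_one (classCard_nonneg c) hij
    (by linarith) (by linarith)
  have hρ0 : 0 < ρ := by linarith
  have hup := energy_le_of_coloring hG hρ0 hρ.le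
  set n := classCard c with hn
  have hn0 : ∀ l, 0 ≤ n l := classCard_nonneg c
  have hpos : ∀ l, 0 < ρ + n l := fun l => by have := hn0 l; positivity
  set φ : ι → ℝ := fun l => 1 / (ρ + n l) with hφ
  have hφ0 : ∀ l, 0 < φ l := fun l => one_div_pos.mpr (hpos l)
  set x : V → ℝ := fun p => φ (c p) with hx
  have hxx : x ⬝ᵥ x = ∑ l, n l * φ l ^ 2 := dotProduct_comp_self c φ
  have hxA : x ⬝ᵥ G.adjMatrix ℝ *ᵥ x = ρ * (x ⬝ᵥ x) := by
    rw [dotProduct_adjMatrix_of_coloring hG, sum_comp_eq c φ,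
      show ∑ l, classCard c l * φ l = 1 by
        rw [← hρ]; exact Finset.sum_congr rfl fun l _ => by simp only [hφ]; ring,
      hxx, Finset.mul_sum, one_pow, ← hρ, ← Finset.sum_sub_distrib]
    refine Finset.sum_congr rfl fun l _ => ?_
    rw [show classSum c x l = n l * φ l from classSum_comp c φ l]
    simp only [hφ]
    have := (hpos l).ne'
    field_simp
    ring
  have hN : 4 * (φ i * φ j) < x ⬝ᵥ x := by
    rw [hxx]
    have hpair : n i * φ i ^ 2 + n j * φ j ^ 2 ≤ ∑ l, n l * φ l ^ 2 := by
      rw [← Finset.sum_pair (f := fun l => n l * φ l ^ 2) hij]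
      exact Finset.sum_le_sum_of_subset_of_nonneg (Finset.subset_univ _)
        fun l _ _ => mul_nonneg (hn0 l) (sq_nonneg _)
    have h1 : 2 * φ i ^ 2 ≤ n i * φ i ^ 2 := by gcongr
    have h2 : 2 * φ j ^ 2 ≤ n j * φ j ^ 2 := by gcongr
    have h3 := sq_nonneg (φ i - φ j)
    rcases hstrict with h | h | ⟨l, hli, hlj, hl⟩
    · have : 2 * φ i ^ 2 < n i * φ i ^ 2 :=
        mul_lt_mul_of_pos_right h (pow_pos (hφ0 i) 2)
      linarith
    · have : 2 * φ j ^ 2 < n j * φ j ^ 2 :=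
        mul_lt_mul_of_pos_right h (pow_pos (hφ0 j) 2)
      linarith
    · have htri : n l * φ l ^ 2 + (n i * φ i ^ 2 + n j * φ j ^ 2) ≤ ∑ l, n l * φ l ^ 2 := by
        rw [← Finset.sum_pair (f := fun l => n l * φ l ^ 2) hij,
          ← Finset.sum_insert (f := fun l => n l * φ l ^ 2) (by simp [hli, hlj])]
        exact Finset.sum_le_sum_of_subset_of_nonneg (Finset.subset_univ _)
          fun l _ _ => mul_nonneg (hn0 l) (sq_nonneg _)
      have : 0 < n l * φ l ^ 2 := mul_pos (by linarith) (pow_pos (hφ0 l) 2)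
      linarith
  have hx0 : 0 < x ⬝ᵥ x := (mul_pos four_pos (mul_pos (hφ0 i) (hφ0 j))).trans hN
  have hne : u ≠ v := huv.ne
  set a := n i
  set b := n j
  set ψ : ι → ℝ := fun l => if l = i then -(b - 1) else if l = j then a - 1 else 0 with hψ
  -- Zero sum on every class: `(a-1)(b-1)` at `u` is balanced by `-(b-1)` on the rest of its class,
  -- and with opposite signs for `v`. This makes `y` orthogonal to all class functions and `y u * y
  -- v` negative.
  set y : V → ℝ := modClass c ψ u (a * (b - 1)) v (-(b * (a - 1))) with hy
  have hycs : ∀ l, classSum c y l = 0 := by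
    intro l
    rw [hy, classSum_modClass, hu, hv]
    by_cases h1 : l = i
    · subst h1
      simp only [hψ, if_true, if_neg hij.symm]
      ring
    · by_cases h2 : l = j
      · subst h2
        simp only [hψ, if_true, if_neg h1, if_neg hij]
        ring
      · simp [hψ, h1, h2, Ne.symm h1, Ne.symm h2]
  have hyu : y u = (a - 1) * (b - 1) := by
    simp only [hy, modClass, hu, hψ, if_true, if_neg hne]
    ring
  have hyv : y v = -((a - 1) * (b - 1)) := by
    simp only [hy, modClass, hv, hψ, if_true, if_neg hne.symm, if_neg hij.symm]
    ring
  have hyy : y ⬝ᵥ y = (a - 1) * (b - 1) * (a * (b - 1) + b * (a - 1)) := by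
    conv_lhs => rw [hy]
    rw [modClass_dotProduct, ← hy, hyu, hyv]
    simp only [hycs]
    simp
    ring
  have hxy : x ⬝ᵥ y = 0 := by
    have hx' : x = modClass c φ u 0 v 0 := by
      ext p
      simp [hx, modClass]
    rw [hx', modClass_dotProduct]
    simp [hycs]
  have ha1 : 0 < a - 1 := by linarith
  have hb1 : 0 < b - 1 := by linarith
  have hR0 : 0 < a * (b - 1) + b * (a - 1) := by
    have := mul_pos (by linarith : 0 < a) hb1
    have := mul_pos (by linarith : 0 < b) ha1
    linarith
  have hy0 : 0 < y ⬝ᵥ y := by rw [hyy]; positivity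
  have hyA : y ⬝ᵥ G.adjMatrix ℝ *ᵥ y = 0 := by
    rw [dotProduct_adjMatrix_of_coloring hG, ← sum_classSum c]
    simp [hycs]
  have hlow := two_mul_rayleigh_add_rayleigh_le_energy (G := G.deleteEdges {s(u, v)}) x y hxy
    hx0 hy0
  rw [dotProduct_adjMatrix_deleteEdge huv, dotProduct_adjMatrix_deleteEdge huv, hxA, hyA, hyu,
    hyv] at hlow
  have hxuv : x u * x v = φ i * φ j := by simp only [hx, hu, hv]
  rw [hxuv] at hlow
  have h1 : ρ - 1 / 2 < (ρ * (x ⬝ᵥ x) - 2 * (φ i * φ j)) / (x ⬝ᵥ x) := by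
    rw [lt_div_iff₀ hx0]
    linarith
  have h2 : 1 / 2 ≤ (0 - 2 * ((a - 1) * (b - 1) * -((a - 1) * (b - 1)))) / (y ⬝ᵥ y) := by
    rw [hyy, div_le_div_iff₀ two_pos (by positivity)]
    have h3 : a * (b - 1) + b * (a - 1) ≤ 4 * ((a - 1) * (b - 1)) := by nlinarith
    have h4 := mul_le_mul_of_nonneg_left h3 (mul_pos ha1 hb1).le
    linarith
  linarith

/-- Deleting an edge of the `4`-cycle increases the energy. -/
theorem energy_lt_deleteEdge_of_two_two [Fintype ι] (hG : ∀ p q, G.Adj p q ↔ c p ≠ c q)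
    (hu : c u = i) (hv : c v = j) (hij : i ≠ j) (hi : classCard c i = 2) (hj : classCard c j = 2)
    (hι : ∀ m, m = i ∨ m = j) :
    G.energy < (G.deleteEdges {s(u, v)}).energy := by
  classical
  have huv : G.Adj u v := by rw [hG, hu, hv]; exact hij
  have hne : u ≠ v := huv.ne
  have hup := energy_le_of_coloring hG (ρ := 2) two_pos (by
    rw [sum_univ_of_two hij hι, hi, hj]; norm_num)
  -- Along the remaining path, `x = (1,2,2,1)` and `y = (2,1,-1,-2)`: the positive eigenvectors with
  -- the golden ratio rounded to 2. The Rayleigh quotients 8/5 and 3/5 already sum to more than 2.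
  set x : V → ℝ := modClass c (fun _ => 2) u (-1) v (-1) with hx
  set y : V → ℝ := modClass c (fun l => if l = i then -1 else 1) u 3 v (-3) with hy
  have hxi : classSum c x i = 3 := by
    rw [hx, classSum_modClass, hu, hv, hi, if_pos rfl, if_neg hij.symm]; norm_num
  have hxj : classSum c x j = 3 := by
    rw [hx, classSum_modClass, hu, hv, hj, if_pos rfl, if_neg hij]; norm_num
  have hyi : classSum c y i = 1 := by
    rw [hy, classSum_modClass, hu, hv, hi, if_pos rfl, if_pos rfl, if_neg hij.symm]; norm_num
  have hyj : classSum c y j = -1 := by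
    rw [hy, classSum_modClass, hu, hv, hj, if_pos rfl, if_neg hij, if_neg hij.symm]; norm_num
  have hxu : x u = 1 := by simp only [hx, modClass, if_true, if_neg hne]; norm_num
  have hxv : x v = 1 := by simp only [hx, modClass, if_true, if_neg hne.symm]; norm_num
  have hyu : y u = 2 := by simp only [hy, modClass, hu, if_true, if_neg hne]; norm_num
  have hyv : y v = -2 := by
    simp only [hy, modClass, hv, if_true, if_neg hne.symm, if_neg hij.symm]; norm_num
  have hxx : x ⬝ᵥ x = 10 := by
    conv_lhs => rw [hx]
    rw [modClass_dotProduct, ← hx, sum_univ_of_two hij hι, hxi, hxj, hxu, hxv]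
    norm_num
  have hyy : y ⬝ᵥ y = 10 := by
    conv_lhs => rw [hy]
    rw [modClass_dotProduct, ← hy, sum_univ_of_two hij hι, hyi, hyj, hyu, hyv, if_pos rfl,
      if_neg hij.symm]
    norm_num
  have hxy : x ⬝ᵥ y = 0 := by
    rw [hx, modClass_dotProduct, sum_univ_of_two hij hι, hyi, hyj, hyu, hyv]
    norm_num
  have hlow := two_mul_rayleigh_add_rayleigh_le_energy (G := G.deleteEdges {s(u, v)}) x y hxy
    (by rw [hxx]; norm_num) (by rw [hyy]; norm_num)
  rw [dotProduct_adjMatrix_deleteEdge huv, dotProduct_adjMatrix_deleteEdge huv,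
    dotProduct_adjMatrix_of_coloring hG, dotProduct_adjMatrix_of_coloring hG, ← sum_classSum c x,
    ← sum_classSum c y, sum_univ_of_two hij hι, sum_univ_of_two hij hι, sum_univ_of_two hij hι,
    sum_univ_of_two hij hι, hxi, hxj, hyi, hyj, hxu, hxv, hyu, hyv, hxx, hyy] at hlow
  norm_num at hlow
  linarith

/-- A root of the secular equation is an eigenvalue. -/
theorem exists_eigenvector_deleteEdge [Fintype ι] (hG : ∀ p q, G.Adj p q ↔ c p ≠ c q)
    [DecidableRel (G.deleteEdges {s(u, v)}).Adj]
    (hu : ∀ p, c p = i ↔ p = u) (hv : c v = j) (hij : i ≠ j) {k : ℝ} (hk : 0 ≤ k)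
    (hj : classCard c j = k + 1) {x : ℝ} (hx : 0 < x)
    (hroot : (∑ l ∈ (univ.erase i).erase j, classCard c l / (x + classCard c l)) *
      secularCubic k x = x * (x ^ 2 - k)) :
    ∃ f : V → ℝ, 0 < f ⬝ᵥ f ∧ (G.deleteEdges {s(u, v)}).adjMatrix ℝ *ᵥ f = x • f := by
  have hu' : c u = i := (hu u).mpr rfl
  have huv : G.Adj u v := by rw [hG, hu', hv]; exact hij
  have hne : u ≠ v := huv.ne
  set n := classCard c with hn
  have hn0 : ∀ l, 0 ≤ n l := classCard_nonneg c
  have hni : n i = 1 := classCard_eq_one_of_unique hu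
  set D := secularCubic k x with hD
  -- The eigenvalue equations solved in terms of the total, scaled so that the total is `D`. The
  -- consistency condition `hS` on the total is then exactly the secular equation.
  set φ : ι → ℝ := fun l => if l = i then x * (x + k) else if l = j then x * (x + 1)
    else D / (x + n l) with hφ
  set f : V → ℝ := modClass c φ u 0 v (-(x + k)) with hf
  have hφi : φ i = x * (x + k) := by simp [hφ]
  have hφj : φ j = x * (x + 1) := by simp [hφ, hij.symm]
  have hφl : ∀ l, l ≠ i → l ≠ j → φ l = D / (x + n l) := fun l h1 h2 => by simp [hφ, h1, h2]
  have hfi : classSum c f i = x * (x + k) := by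
    rw [hf, classSum_modClass, hu', hv, if_pos rfl, if_neg hij.symm, ← hn, hni, hφi]; ring
  have hfj : classSum c f j = (k + 1) * (x * (x + 1)) - (x + k) := by
    rw [hf, classSum_modClass, hu', hv, if_pos rfl, if_neg hij, ← hn, hj, hφj]; ring
  have hfl : ∀ l, l ≠ i → l ≠ j → classSum c f l = n l / (x + n l) * D := by
    intro l h1 h2
    rw [hf, classSum_modClass, hu', hv, if_neg h1.symm, if_neg h2.symm, ← hn, hφl l h1 h2]; ring
  have hfu : f u = x * (x + k) := by
    simp only [hf, modClass, hu', hφi, if_true, if_neg hne]; ring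
  have hfv : f v = x ^ 2 - k := by
    simp only [hf, modClass, hv, hφj, if_true, if_neg hne.symm]; ring
  have hS : ∑ q, f q = D := by
    rw [← sum_classSum c, ← Finset.add_sum_erase _ _ (mem_univ i),
      ← Finset.add_sum_erase _ _ (mem_erase.mpr ⟨hij.symm, mem_univ j⟩), hfi, hfj,
      Finset.sum_congr rfl fun l hl => hfl l (mem_erase.mp (mem_erase.mp hl).2).1
        (mem_erase.mp hl).1, ← Finset.sum_mul, hroot, hD, secularCubic]
    ring
  refine ⟨f, ?_, ?_⟩
  · refine lt_of_lt_of_le (mul_self_pos.mpr (?_ : f u ≠ 0)) (Finset.single_le_sum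
      (f := fun p => f p * f p) (fun p _ => mul_self_nonneg _) (mem_univ u))
    rw [hfu]
    positivity
  · ext p
    rw [mulVec_adjMatrix_deleteEdge huv, mulVec_adjMatrix_of_coloring hG, hS, Pi.smul_apply,
      smul_eq_mul]
    by_cases h1 : p = u
    · subst h1
      rw [if_pos rfl, if_neg hne, hu', hfi, hfu, hfv, hD, secularCubic]
      ring
    by_cases h2 : p = v
    · subst h2
      rw [if_pos rfl, if_neg h1, hv, hfj, hfu, hfv, hD, secularCubic]
      ring
    rw [if_neg h1, if_neg h2]
    have h3 : c p ≠ i := fun h => h1 ((hu p).mp h)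
    have hfp : f p = φ (c p) := by simp [hf, modClass, h1, h2]
    rw [hfp]
    by_cases h4 : c p = j
    · rw [h4, hfj, hφj, hD, secularCubic]
      ring
    · rw [hfl _ h3 h4, hφl _ h3 h4]
      have := hn0 (c p)
      field_simp
      ring

theorem energy_lt_deleteEdge_of_one [Fintype ι] (hG : ∀ p q, G.Adj p q ↔ c p ≠ c q)
    (hn1 : ∀ l, 1 ≤ classCard c l) (hu : ∀ p, c p = i ↔ p = u) (hv : c v = j) (hij : i ≠ j)
    (hcard : (∃ l, l ≠ i ∧ l ≠ j) ∧ 3 ≤ classCard c j ∨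
      (∃ l m, l ≠ m ∧ l ≠ i ∧ l ≠ j ∧ m ≠ i ∧ m ≠ j) ∧ classCard c j = 2) :
    G.energy < (G.deleteEdges {s(u, v)}).energy := by
  classical
  have hni : classCard c i = 1 := classCard_eq_one_of_unique hu
  obtain ⟨ρ, hρ1, hρ⟩ := exists_sum_div_add_eq_one (classCard_nonneg c) hij (hn1 i) (hn1 j)
  have hρ0 : 0 < ρ := by linarith
  have hup := energy_le_of_coloring hG hρ0 hρ.le
  obtain ⟨k, hk⟩ : ∃ k, k = classCard c j - 1 := ⟨_, rfl⟩
  have hk0 : 0 ≤ k := by linarith [hn1 j]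
  have hj : classCard c j = k + 1 := by linarith
  -- The equation for `ρ` in `G`, solved for the contribution of the untouched classes.
  have hsum : ∑ l ∈ (univ.erase i).erase j, classCard c l / (ρ + classCard c l) =
      (ρ ^ 2 - (k + 1)) / ((ρ + 1) * (ρ + (k + 1))) := by
    rw [← Finset.add_sum_erase _ _ (mem_univ i),
      ← Finset.add_sum_erase _ _ (mem_erase.mpr ⟨hij.symm, mem_univ j⟩), hni, hj] at hρ
    rw [eq_sub_of_add_eq' (eq_sub_of_add_eq' hρ)]
    field_simp
    ring
  have hmem : ∀ l, l ≠ i → l ≠ j → l ∈ (univ.erase i).erase j := fun l h1 h2 => by simp [h1, h2]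
  obtain ⟨x, y, hx0, hxy, hlt, hxr, hyr⟩ : ∃ x y : ℝ, 0 < x ∧ x < y ∧ ρ < x + y ∧
      (∑ l ∈ (univ.erase i).erase j, classCard c l / (x + classCard c l)) * secularCubic k x =
        x * (x ^ 2 - k) ∧
      (∑ l ∈ (univ.erase i).erase j, classCard c l / (y + classCard c l)) * secularCubic k y =
        y * (y ^ 2 - k) := by
    rcases hcard with ⟨⟨l, hli, hlj⟩, h3⟩ | ⟨⟨l, m, hlm, hli, hlj, hmi, hmj⟩, h2⟩
    · exact exists_secular_roots_of_two_le ⟨l, hmem l hli hlj⟩ (fun l _ => hn1 l) (by linarith)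
        hρ0 hsum
    · obtain rfl : k = 1 := by linarith
      exact exists_secular_roots_of_one (fun l _ => hn1 l) (hmem l hli hlj) (hmem m hmi hmj) hlm
        hρ0 hsum
  obtain ⟨f, hf0, hf⟩ := exists_eigenvector_deleteEdge hG hu hv hij hk0 hj hx0 hxr
  obtain ⟨g, hg0, hg⟩ := exists_eigenvector_deleteEdge hG hu hv hij hk0 hj (hx0.trans hxy) hyr
  have := two_mul_add_le_energy hxy.ne hf hg hf0 hg0
  linarith

end DeleteEdge

/-! ### Deletions that decrease the energy. -/

section DeleteEdgeDecrease

variable {V ι : Type*} [Fintype V] [DecidableEq V] [DecidableEq ι]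
variable {G : SimpleGraph V} [DecidableRel G.Adj] {c : V → ι} {u v : V} {i j : ι}

/-- Deleting the edge between two singleton classes merges them. -/
theorem deleteEdge_energy_lt_of_one_one [Fintype ι] (hG : ∀ p q, G.Adj p q ↔ c p ≠ c q)
    (hn1 : ∀ l, 1 ≤ classCard c l) (hu : ∀ p, c p = i ↔ p = u) (hv : ∀ p, c p = j ↔ p = v)
    (hij : i ≠ j) {l : ι} (hli : l ≠ i) (hlj : l ≠ j) :
    (G.deleteEdges {s(u, v)}).energy < G.energy := by
  classical
  -- Class `j` stays in the index type as an empty class, contributing 0 to the secular sum.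
  set c' : V → ι := fun p => if c p = j then i else c p with hc'
  have hG' : ∀ p q, (G.deleteEdges {s(u, v)}).Adj p q ↔ c' p ≠ c' q := by
    have key : ∀ a b : ι, a ≠ b ∧ ¬(a = i ∧ b = j ∨ a = j ∧ b = i) ↔
        (if a = j then i else a) ≠ (if b = j then i else b) := by
      intro a b
      grind
    intro p q
    rw [deleteEdges_adj, hG, Set.mem_singleton_iff, Sym2.eq_iff, ← hu, ← hu, ← hv, ← hv]
    exact key (c p) (c q)
  have hni : classCard c i = 1 := classCard_eq_one_of_unique hu
  have hnj : classCard c j = 1 := classCard_eq_one_of_unique hv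
  have hni' : classCard c' i = 2 := by
    have : classCard c' i = classCard c i + classCard c j := by
      simp only [classCard, classSum, ← Finset.sum_add_distrib, hc']
      refine Finset.sum_congr rfl fun p _ => ?_
      by_cases h : c p = j <;> simp [h, hij.symm]
    rw [this, hni, hnj]
    norm_num
  have hnj' : classCard c' j = 0 := by
    refine Finset.sum_eq_zero fun p _ => if_neg ?_
    simp only [hc']
    split_ifs with h
    · exact hij
    · exact h
  have hnm' : ∀ m, m ≠ i → m ≠ j → classCard c' m = classCard c m := by
    intro m hmi hmj
    simp only [classCard, classSum, hc']
    refine Finset.sum_congr rfl fun p _ => ?_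
    by_cases h : c p = j
    · simp [h, hmi.symm, hmj.symm]
    · simp [h]
  obtain ⟨ρ, hρ1, hρ⟩ := exists_sum_div_add_eq_one (classCard_nonneg c') hli.symm
    (by rw [hni']; norm_num) (by rw [hnm' l hli hlj]; exact hn1 l)
  have hρ0 : 0 < ρ := by linarith
  refine (energy_le_of_coloring hG' hρ0 hρ.le).trans_lt (lt_energy_of_coloring hG hρ0 ?_)
  have hmemj : j ∈ univ.erase i := mem_erase.mpr ⟨hij.symm, mem_univ j⟩
  rw [← hρ, ← Finset.add_sum_erase _ _ (mem_univ i), ← Finset.add_sum_erase _ _ hmemj,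
    ← Finset.add_sum_erase univ (fun l => classCard c l / (ρ + classCard c l)) (mem_univ i),
    ← Finset.add_sum_erase _ (fun l => classCard c l / (ρ + classCard c l)) hmemj,
    Finset.sum_congr rfl fun m hm => by
      rw [hnm' m (mem_erase.mp (mem_erase.mp hm).2).1 (mem_erase.mp hm).1], hni, hnj, hni', hnj']
  -- One class of size 2 weighs less than two of size 1, so at the root for the merged graph the sum
  -- for `G` exceeds 1.
  have h1 : 2 / (ρ + 2) < 1 / (ρ + 1) + 1 / (ρ + 1) := by
    rw [← add_div, div_lt_div_iff₀ (by positivity) (by positivity)]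
    linarith
  rw [zero_div]
  linarith

/-- A star with `b` leaves loses one of them: `√(b - 1) < √b`. -/
theorem deleteEdge_star_energy_lt [Fintype ι] (hG : ∀ p q, G.Adj p q ↔ c p ≠ c q)
    (hu : ∀ p, c p = i ↔ p = u) (hv : c v = j) (hij : i ≠ j) (hι : ∀ m, m = i ∨ m = j)
    (hj : 1 ≤ classCard c j) :
    (G.deleteEdges {s(u, v)}).energy < G.energy := by
  classical
  have hu' : c u = i := (hu u).mpr rfl
  have huv : G.Adj u v := by rw [hG, hu', hv]; exact hij
  have hne : u ≠ v := huv.ne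
  have hni : classCard c i = 1 := classCard_eq_one_of_unique hu
  set b := classCard c j with hb
  -- A separating value strictly between the two spectral radii, positive even when `b = 1`.
  set ρ := √(b - 1 / 2) with hρ
  have hρ0 : 0 < ρ := Real.sqrt_pos.mpr (by linarith)
  have hρ2 : ρ ^ 2 = b - 1 / 2 := Real.sq_sqrt (by linarith)
  have hlow : 2 * ρ < G.energy := by
    refine lt_energy_of_coloring hG hρ0 ?_
    rw [sum_univ_of_two hij hι, hni, ← hb, div_add_div _ _ (by positivity) (by positivity),
      lt_div_iff₀ (by positivity)]
    nlinarith
  have hform : ∀ x : V → ℝ, x ⬝ᵥ (G.deleteEdges {s(u, v)}).adjMatrix ℝ *ᵥ x =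
      2 * x u * (classSum c x j - x v) := by
    intro x
    rw [dotProduct_adjMatrix_deleteEdge huv, dotProduct_adjMatrix_of_coloring hG,
      ← sum_classSum c x, sum_univ_of_two hij hι, sum_univ_of_two hij hι,
      classSum_eq_of_unique hu]
    ring
  refine lt_of_le_of_lt (energy_le_of_nonpos_on_hyperplane (Pi.single u 1) ρ hρ0.le
    (fun x hx => ?_) fun x => ?_) hlow
  · have hx0 : x u = 0 := by simpa using hx
    rw [hform, hx0]
    simp
  · rw [hform]
    -- Moving `v` out of class `j` leaves there just the surviving leaves, so Cauchy–Schwarz gains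
    -- the factor `b - 1`.
    set c' : V → ι := fun p => if p = v then i else c p with hc'
    have hsum : ∀ y : V → ℝ, classSum c' y j = classSum c y j - y v := by
      intro y
      have h : ∀ p, (if c' p = j then y p else 0) =
          (if c p = j then y p else 0) - (if p = v then y p else 0) := by
        intro p
        by_cases h : p = v
        · subst h; simp [hc', hij, hv]
        · simp [hc', h]
      simp only [classSum, h, Finset.sum_sub_distrib, Finset.sum_ite_eq', Finset.mem_univ, if_true]
    have hcs := sq_classSum_le c' x j
    rw [classCard, hsum, hsum, ← classCard, ← hb] at hcs
    set s := classSum c x j - x v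
    set q := classSum c' (fun p => x p ^ 2) j with hq
    have hq0 : 0 ≤ q := Finset.sum_nonneg fun p _ => by split_ifs <;> positivity
    have hxx : x u ^ 2 + q ≤ x ⬝ᵥ x := by
      have h1 : x ⬝ᵥ x = ∑ p, x p ^ 2 := by simp only [dotProduct, sq]
      rw [h1, ← sum_classSum c', sum_univ_of_two hij hι]
      gcongr
      have h2 := Finset.single_le_sum (f := fun p => if c' p = i then x p ^ 2 else 0)
        (fun p _ => by split_ifs <;> positivity) (mem_univ u)
      simpa [hc', hne, hu', classSum] using h2
    have hs : s ^ 2 ≤ ρ ^ 2 * q := by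
      refine hcs.trans ?_
      rw [hρ2]
      gcongr
      linarith
    have h1 : 2 * x u * s * ρ ≤ ρ ^ 2 * (x u ^ 2 + q) := by
      nlinarith [sq_nonneg (ρ * x u - s)]
    have h2 : 2 * x u * s ≤ ρ * (x u ^ 2 + q) := by
      refine le_of_mul_le_mul_right ?_ hρ0
      linarith
    exact h2.trans (by gcongr)

/-- After deletion `u` and `w` are adjacent twins, so `e_u - e_w` is an eigenvector for `-1`; it
costs 1 in the trace of the certificate. The remaining negative part is covered by one rank-one term
of trace less than `ρ - 1`. -/
theorem deleteEdge_energy_lt_of_one_two [Fintype ι] (hG : ∀ p q, G.Adj p q ↔ c p ≠ c q)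
    {w : V} {l : ι} (hu : ∀ p, c p = i ↔ p = u) (hj : ∀ p, c p = j ↔ p = v ∨ p = w) (hvw : v ≠ w)
    (hij : i ≠ j) (hil : i ≠ l) (hjl : j ≠ l) (hι : ∀ m, m = i ∨ m = j ∨ m = l)
    (hl : 1 ≤ classCard c l) :
    (G.deleteEdges {s(u, v)}).energy < G.energy := by
  classical
  have hu' : c u = i := (hu u).mpr rfl
  have hv : c v = j := (hj v).mpr (Or.inl rfl)
  have hw : c w = j := (hj w).mpr (Or.inr rfl)
  have huv : G.Adj u v := by rw [hG, hu', hv]; exact hij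
  have hne : u ≠ v := huv.ne
  have huw : u ≠ w := by rintro rfl; exact hij (hu'.symm.trans hw)
  have hsj : ∀ x : V → ℝ, classSum c x j = x v + x w := by
    intro x
    have h : ∀ p, (if c p = j then x p else 0) =
        (if p = v then x p else 0) + (if p = w then x p else 0) := by
      intro p
      by_cases h1 : p = v
      · subst h1; simp [hv, hvw]
      · simp [hj, h1]
    simp [classSum, h, Finset.sum_add_distrib]
  have hni : classCard c i = 1 := classCard_eq_one_of_unique hu
  have hnj : classCard c j = 2 := by rw [classCard, hsj]; norm_num
  obtain ⟨ρ, hρ1, hρ⟩ := exists_sum_div_add_eq_one (classCard_nonneg c) hij hni.ge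
    (by rw [hnj]; norm_num)
  have hρ0 : 0 < ρ := by linarith
  have hlow := le_energy_of_coloring hG hρ0 hρ
  rw [sum_univ_of_three hij hil hjl hι, hni, hnj] at hρ
  set t := classCard c l with ht
  have hcub : ρ ^ 3 = (3 * t + 2) * ρ + 4 * t := by
    field_simp at hρ
    linear_combination -hρ
  have hρ1' : 1 < ρ := hρ1.lt_of_ne fun h => by
    rw [← h] at hcub
    linarith
  set r := ρ - 1 with hr
  have hr0 : 0 < r := by linarith
  -- `-α` and `-β` are the entries at `u`, `w` and at `v` of a vector equal to 1 on class `l` that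
  -- satisfies the eigenvalue equations at these three vertices for the trial value `-(ρ - 1)`.
  obtain ⟨α, hα⟩ : ∃ α, α = t / ρ := ⟨_, rfl⟩
  obtain ⟨β, hβ⟩ : ∃ β, β = t / r := ⟨_, rfl⟩
  obtain ⟨d, hd⟩ : ∃ d, d = β - α := ⟨_, rfl⟩
  -- The unique `γ` for which the form left after completing the square in the class sum `s` is
  -- degenerate, hence a single square in `x u + x w` and `x v`.
  obtain ⟨γ, hγ⟩ : ∃ γ, γ = 2 * (β - d ^ 2) := ⟨_, rfl⟩
  have hkey : t * (3 * ρ ^ 2 - 2 * ρ) < ρ ^ 2 * r ^ 2 := by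
    have h0 : 0 < 6 * t + 3 * ρ - 2 * ρ ^ 2 := by
      have e : (6 * t + 3 * ρ - 2 * ρ ^ 2) * (3 * ρ + 4) = ρ ^ 2 := by
        linear_combination (-6 : ℝ) * hcub
      exact (pos_iff_pos_of_mul_pos (e ▸ pow_pos hρ0 2)).mpr (by positivity)
    have e : ρ ^ 2 * r ^ 2 - t * (3 * ρ ^ 2 - 2 * ρ) = ρ * (6 * t + 3 * ρ - 2 * ρ ^ 2) := by
      rw [hr]
      linear_combination ρ * hcub
    have := mul_pos hρ0 h0
    linarith
  have hd' : d = t / (ρ * r) := by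
    rw [hd, hα, hβ]
    field_simp
    rw [hr]
    ring
  have hγ' : γ * (ρ ^ 2 * r ^ 2) = 2 * t * (ρ ^ 2 * r - t) := by
    rw [hγ, hd', hβ]
    field_simp
  have hγ0 : 0 < γ := by
    have h1 : 0 < ρ ^ 2 * r - t := by
      rw [hr]
      nlinarith
    exact (pos_iff_pos_of_mul_pos (hγ' ▸ mul_pos (by linarith) h1)).mpr (by positivity)
  have htrace : (t + 2 * α ^ 2 + β ^ 2) / γ < r := by
    rw [div_lt_iff₀ hγ0]
    have h1 : (t + 2 * α ^ 2 + β ^ 2) * (ρ ^ 2 * r ^ 2) < r * γ * (ρ ^ 2 * r ^ 2) := by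
      rw [mul_assoc, hγ', hα, hβ]
      field_simp
      rw [hr] at hkey ⊢
      nlinarith
    exact lt_of_mul_lt_mul_right h1 (by positivity)
  set f : V → ℝ := Pi.single u 1 - Pi.single w 1 with hf
  set g : V → ℝ := (fun p => if c p = l then 1 else 0) - α • (Pi.single u 1 + Pi.single w 1)
    - β • Pi.single v 1 with hg
  have hfx : ∀ x : V → ℝ, f ⬝ᵥ x = x u - x w := by
    intro x
    simp [hf, sub_dotProduct]
  have hgx : ∀ x : V → ℝ, g ⬝ᵥ x = classSum c x l - α * (x u + x w) - β * x v := by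
    intro x
    simp only [hg, sub_dotProduct, smul_dotProduct, add_dotProduct, single_one_dotProduct,
      smul_eq_mul]
    simp [classSum, dotProduct]
  have hff : f ⬝ᵥ f = 2 := by
    rw [hfx]
    simp [hf, huw, huw.symm]
    norm_num
  have hgu : g u = -α := by simp [hg, hu', hil, hne, huw]
  have hgw : g w = -α := by simp [hg, hw, hjl, huw.symm, hvw.symm]
  have hgv : g v = -β := by simp [hg, hv, hjl, hne.symm, hvw]
  have hgl : classSum c g l = t := by
    rw [ht]
    refine Finset.sum_congr rfl fun p _ => ?_
    by_cases h : c p = l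
    · have h1 : p ≠ u := by rintro rfl; exact hil (hu'.symm.trans h)
      have h2 : p ≠ v := by rintro rfl; exact hjl (hv.symm.trans h)
      have h3 : p ≠ w := by rintro rfl; exact hjl (hw.symm.trans h)
      simp [hg, h, h1, h2, h3]
    · simp [h]
  have hgg : g ⬝ᵥ g = t + 2 * α ^ 2 + β ^ 2 := by
    rw [hgx, hgl, hgu, hgv, hgw]
    ring
  set N : Matrix V V ℝ := (1 / 2 : ℝ) • vecMulVec f f + (1 / γ) • vecMulVec g g with hN
  have hNx : ∀ x : V → ℝ, x ⬝ᵥ N *ᵥ x = 1 / 2 * (f ⬝ᵥ x) ^ 2 + 1 / γ * (g ⬝ᵥ x) ^ 2 := by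
    intro x
    simp only [hN, add_mulVec, smul_mulVec, vecMulVec_mulVec, dotProduct_add, dotProduct_smul]
    simp only [dotProduct_comm x, smul_eq_mul, MulOpposite.smul_eq_mul_unop, MulOpposite.unop_op]
    ring
  have hNtr : N.trace = 1 + (t + 2 * α ^ 2 + β ^ 2) / γ := by
    simp only [hN, trace_add, trace_smul, trace_vecMulVec, hff, hgg, smul_eq_mul]
    ring
  have hup := energy_le_two_mul_trace (G := G.deleteEdges {s(u, v)}) N (fun x => by
      rw [hNx]; positivity) fun x => by
    rw [hNx, hfx, hgx, dotProduct_adjMatrix_deleteEdge huv, dotProduct_adjMatrix_of_coloring hG,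
      ← sum_classSum c x, sum_univ_of_three hij hil hjl hι, sum_univ_of_three hij hil hjl hι,
      classSum_eq_of_unique hu, hsj]
    set s := classSum c x l
    have e : (x u + (x v + x w + s)) ^ 2 - (x u ^ 2 + ((x v + x w) ^ 2 + s ^ 2)) -
        2 * (x u * x v) + (1 / 2 * (x u - x w) ^ 2 +
        1 / γ * (s - α * (x u + x w) - β * x v) ^ 2) =
        1 / γ * (s + (γ - α) * (x u + x w) + (γ - β) * x v) ^ 2 +
        2 * ((d - 1 / 2) * (x u + x w) + d * x v) ^ 2 := by
      have e1 : 1 / γ * (s + (γ - α) * (x u + x w) + (γ - β) * x v) ^ 2 =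
          1 / γ * (s - α * (x u + x w) - β * x v) ^ 2 +
          2 * (s - α * (x u + x w) - β * x v) * (x u + x w + x v) +
          γ * (x u + x w + x v) ^ 2 := by
        field_simp
        ring
      rw [e1, hγ, hd]
      ring
    rw [e]
    positivity
  rw [hNtr] at hup
  linarith

end DeleteEdgeDecrease

/-! ### Specialization to `multipartite t` and the case analysis. -/

theorem classCard_sigma_fst {k : ℕ} (t : Fin k → ℕ) (l : Fin k) :
    classCard (Sigma.fst : (Σ m, Fin (t m)) → Fin k) l = t l := by
  rw [classCard, classSum, Fintype.sum_sigma, Finset.sum_eq_single l]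
  · simp
  · intro m _ hm
    simp [hm]
  · simp

theorem multipartite_adj_iff {k : ℕ} (t : Fin k → ℕ) (p q : Σ m, Fin (t m)) :
    (multipartite t).Adj p q ↔ p.1 ≠ q.1 := Iff.rfl

theorem fst_eq_iff_of_eq_one {k : ℕ} {t : Fin k → ℕ} {i : Fin k} (hi : t i = 1) (u : Fin (t i))
    (p : Σ m, Fin (t m)) : p.1 = i ↔ p = ⟨i, u⟩ := by
  constructor
  · obtain ⟨m, x⟩ := p
    rintro rfl
    have : Subsingleton (Fin (t m)) := by rw [hi]; infer_instance
    rw [Subsingleton.elim x u]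
  · rintro rfl
    rfl

theorem exists_fst_eq_iff_of_eq_two {k : ℕ} {t : Fin k → ℕ} {j : Fin k} (hj : t j = 2)
    (v : Fin (t j)) : ∃ w : Fin (t j), v ≠ w ∧
      ∀ p : Σ m, Fin (t m), p.1 = j ↔ p = ⟨j, v⟩ ∨ p = ⟨j, w⟩ := by
  obtain ⟨w, hw⟩ : ∃ w : Fin (t j), v ≠ w := by
    have : Nontrivial (Fin (t j)) := Fin.nontrivial_iff_two_le.mpr hj.ge
    exact (exists_ne v).imp fun _ h => h.symm
  refine ⟨w, hw, fun p => ⟨?_, ?_⟩⟩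
  · obtain ⟨m, x⟩ := p
    rintro rfl
    have hx : x = v ∨ x = w := by
      have h1 : x.1 < t m := x.2
      have h2 : v.1 < t m := v.2
      have h3 : w.1 < t m := w.2
      have h4 : v.1 ≠ w.1 := fun h => hw (Fin.ext h)
      simp only [Fin.ext_iff]
      change t m = 2 at hj
      omega
    rcases hx with rfl | rfl
    · exact Or.inl rfl
    · exact Or.inr rfl
  · rintro (rfl | rfl) <;> rfl

theorem exists_ne_ne_of_three_le {k : ℕ} (hk : 3 ≤ k) (i j : Fin k) : ∃ l, l ≠ i ∧ l ≠ j := by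
  by_contra! h
  have h1 : (univ : Finset (Fin k)) ⊆ {i, j} := fun l _ => by
    by_cases hl : l = i
    · simp [hl]
    · simp [h l hl]
  have := (Finset.card_le_card h1).trans Finset.card_le_two
  simp at this
  omega

theorem exists_two_ne_ne_of_four_le {k : ℕ} (hk : 4 ≤ k) (i j : Fin k) :
    ∃ l m, l ≠ m ∧ l ≠ i ∧ l ≠ j ∧ m ≠ i ∧ m ≠ j := by
  obtain ⟨l, hli, hlj⟩ := exists_ne_ne_of_three_le (by omega) i j
  by_contra! h
  have h1 : (univ : Finset (Fin k)) ⊆ {i, j, l} := fun m _ => by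
    by_cases hml : m = l
    · simp [hml]
    by_cases hmi : m = i
    · simp [hmi]
    simp [h l m (Ne.symm hml) hli hlj hmi]
  have := (Finset.card_le_card h1).trans Finset.card_le_three
  simp at this
  omega

theorem eq_or_eq_of_two {k : ℕ} (hk : k = 2) {i j : Fin k} (hij : i ≠ j) (m : Fin k) :
    m = i ∨ m = j := by
  subst hk
  fin_cases i <;> fin_cases j <;> fin_cases m <;> simp_all

theorem eq_or_eq_or_eq_of_three {k : ℕ} (hk : k = 3) {i j l : Fin k} (hij : i ≠ j) (hil : i ≠ l)
    (hjl : j ≠ l) (m : Fin k) : m = i ∨ m = j ∨ m = l := by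
  subst hk
  omega

variable {k : ℕ} {t : Fin k → ℕ} {i j : Fin k}

theorem multipartite_lt_deleteEdge_of_two_le (ht : ∀ l, 1 ≤ t l) (hij : i ≠ j) (u : Fin (t i))
    (v : Fin (t j)) (hi : 2 ≤ t i) (hj : 2 ≤ t j) :
    (multipartite t).energy <
      ((multipartite t).deleteEdges {s(⟨i, u⟩, ⟨j, v⟩)}).energy := by
  classical
  have hG := multipartite_adj_iff t
  by_cases h : 2 < t i ∨ 2 < t j ∨ ∃ l, l ≠ i ∧ l ≠ j
  · refine energy_lt_deleteEdge_of_two_le hG rfl rfl hij ?_ ?_ ?_ <;>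
      simp only [classCard_sigma_fst]
    · exact_mod_cast hi
    · exact_mod_cast hj
    · rcases h with h | h | ⟨l, h1, h2⟩
      · exact Or.inl (by exact_mod_cast h)
      · exact Or.inr (Or.inl (by exact_mod_cast h))
      · exact Or.inr (Or.inr ⟨l, h1, h2, by exact_mod_cast ht l⟩)
  · push Not at h
    refine energy_lt_deleteEdge_of_two_two hG rfl rfl hij ?_ ?_ fun m => ?_
    · rw [classCard_sigma_fst, le_antisymm h.1 hi]; norm_num
    · rw [classCard_sigma_fst, le_antisymm h.2.1 hj]; norm_num
    · by_cases hm : m = i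
      · exact Or.inl hm
      · exact Or.inr (h.2.2 m hm)

theorem multipartite_lt_deleteEdge_of_one (ht : ∀ l, 1 ≤ t l) (hij : i ≠ j) (u : Fin (t i))
    (v : Fin (t j)) (hi : t i = 1) (h : 3 ≤ k ∧ 3 ≤ t j ∨ 4 ≤ k ∧ t j = 2) :
    (multipartite t).energy <
      ((multipartite t).deleteEdges {s(⟨i, u⟩, ⟨j, v⟩)}).energy := by
  classical
  refine energy_lt_deleteEdge_of_one (multipartite_adj_iff t) (fun l => ?_)
    (fst_eq_iff_of_eq_one hi u) rfl hij ?_ <;> simp only [classCard_sigma_fst]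
  · exact_mod_cast ht l
  · rcases h with ⟨hk, hj⟩ | ⟨hk, hj⟩
    · exact Or.inl ⟨exists_ne_ne_of_three_le hk i j, by exact_mod_cast hj⟩
    · exact Or.inr ⟨exists_two_ne_ne_of_four_le hk i j, by exact_mod_cast hj⟩

theorem deleteEdge_multipartite_lt_of_one_one (ht : ∀ l, 1 ≤ t l) (hij : i ≠ j) (u : Fin (t i))
    (v : Fin (t j)) (hi : t i = 1) (hj : t j = 1) (hk : 3 ≤ k) :
    ((multipartite t).deleteEdges {s(⟨i, u⟩, ⟨j, v⟩)}).energy < (multipartite t).energy := by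
  classical
  obtain ⟨l, hli, hlj⟩ := exists_ne_ne_of_three_le hk i j
  refine deleteEdge_energy_lt_of_one_one (multipartite_adj_iff t) (fun l => ?_)
    (fst_eq_iff_of_eq_one hi u) (fst_eq_iff_of_eq_one hj v) hij hli hlj
  rw [classCard_sigma_fst]
  exact_mod_cast ht l

theorem deleteEdge_multipartite_lt_of_one_two (ht : ∀ l, 1 ≤ t l) (hij : i ≠ j) (u : Fin (t i))
    (v : Fin (t j)) (hi : t i = 1) (hj : t j = 2) (hk : k = 3) :
    ((multipartite t).deleteEdges {s(⟨i, u⟩, ⟨j, v⟩)}).energy < (multipartite t).energy := by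
  classical
  obtain ⟨l, hli, hlj⟩ := exists_ne_ne_of_three_le hk.ge i j
  obtain ⟨w, hvw, hw⟩ := exists_fst_eq_iff_of_eq_two hj v
  refine deleteEdge_energy_lt_of_one_two (multipartite_adj_iff t) (fst_eq_iff_of_eq_one hi u) hw
    (fun h => hvw (by simpa using h)) hij hli.symm hlj.symm
    (eq_or_eq_or_eq_of_three hk hij hli.symm hlj.symm) ?_
  rw [classCard_sigma_fst]
  exact_mod_cast ht l

theorem deleteEdge_multipartite_lt_of_star (ht : ∀ l, 1 ≤ t l) (hij : i ≠ j) (u : Fin (t i))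
    (v : Fin (t j)) (hi : t i = 1) (hk : k = 2) :
    ((multipartite t).deleteEdges {s(⟨i, u⟩, ⟨j, v⟩)}).energy < (multipartite t).energy := by
  classical
  refine deleteEdge_star_energy_lt (multipartite_adj_iff t) (fst_eq_iff_of_eq_one hi u) rfl hij
    (eq_or_eq_of_two hk hij) ?_
  rw [classCard_sigma_fst]
  exact_mod_cast ht j

end SimpleGraph

open SimpleGraph in
theorem theorem1p1 {k : ℕ} (t : Fin k → ℕ) (ht : ∀ l, 1 ≤ t l)
    (i j : Fin k) (hij : i ≠ j) (e : Sym2 (Σ l, Fin (t l)))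
    (he : ∃ (u : Fin (t i)) (v : Fin (t j)), e = s(⟨i, u⟩, ⟨j, v⟩)) :
    (4 ≤ k →
      ((t i = 1 ∧ t j = 1) →
        ((multipartite t).deleteEdges {e}).energy < (multipartite t).energy) ∧
      (¬ (t i = 1 ∧ t j = 1) →
        (multipartite t).energy < ((multipartite t).deleteEdges {e}).energy)) ∧
    (k = 3 →
      (t i + t j ≤ 3 →
        ((multipartite t).deleteEdges {e}).energy < (multipartite t).energy) ∧
      (¬ (t i + t j ≤ 3) →
        (multipartite t).energy < ((multipartite t).deleteEdges {e}).energy)) ∧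
    (k = 2 →
      (min (t i) (t j) = 1 →
        ((multipartite t).deleteEdges {e}).energy < (multipartite t).energy) ∧
      (¬ (min (t i) (t j) = 1) →
        (multipartite t).energy < ((multipartite t).deleteEdges {e}).energy)) := by
  obtain ⟨u, v, rfl⟩ := he
  have hi := ht i
  have hj := ht j
  have hswap : s((⟨i, u⟩ : Σ l, Fin (t l)), ⟨j, v⟩) = s(⟨j, v⟩, ⟨i, u⟩) := Sym2.eq_swap
  refine ⟨fun hk => ⟨fun h => ?_, fun h => ?_⟩, fun hk => ⟨fun h => ?_, fun h => ?_⟩,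
    fun hk => ⟨fun h => ?_, fun h => ?_⟩⟩
  · exact deleteEdge_multipartite_lt_of_one_one ht hij u v h.1 h.2 (by omega)
  · by_cases h1 : t i = 1
    · exact multipartite_lt_deleteEdge_of_one ht hij u v h1 (by omega)
    by_cases h2 : t j = 1
    · rw [hswap]
      exact multipartite_lt_deleteEdge_of_one ht hij.symm v u h2 (by omega)
    exact multipartite_lt_deleteEdge_of_two_le ht hij u v (by omega) (by omega)
  · by_cases h1 : t i = 1
    · by_cases h2 : t j = 1
      · exact deleteEdge_multipartite_lt_of_one_one ht hij u v h1 h2 (by omega)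
      · exact deleteEdge_multipartite_lt_of_one_two ht hij u v h1 (by omega) hk
    · rw [hswap]
      exact deleteEdge_multipartite_lt_of_one_two ht hij.symm v u (by omega) (by omega) hk
  · by_cases h1 : t i = 1
    · exact multipartite_lt_deleteEdge_of_one ht hij u v h1 (by omega)
    by_cases h2 : t j = 1
    · rw [hswap]
      exact multipartite_lt_deleteEdge_of_one ht hij.symm v u h2 (by omega)
    exact multipartite_lt_deleteEdge_of_two_le ht hij u v (by omega) (by omega)
  · by_cases h1 : t i = 1
    · exact deleteEdge_multipartite_lt_of_star ht hij u v h1 hk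
    · rw [hswap]
      exact deleteEdge_multipartite_lt_of_star ht hij.symm v u (by omega) hk
  · exact multipartite_lt_deleteEdge_of_two_le ht hij u v (by omega) (by omega)
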